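/- Let $\ell,\alpha,m,J>0$ and $d,\gamma,\gamma^*\ge 0$ with $d\gamma\le 2\gamma^*$. Put $$B=\begin{pmatrix} m & md\\ md & J+md^2\end{pmatrix},\qquad K=\begin{pmatrix}\gamma & 0\\ d\gamma & d\gamma^*\end{pmatrix},\qquad \Gamma(u)=\alpha\begin{pmatrix}-u_{xxx}(0)\\ u_{xx}(0)\end{pmatrix},$$ let $\mathcal V=\{g\in H^2(0,\ell;\mathbb C): g(\ell)=g_x(\ell)=0\}$, and let $\mathcal H=\mathcal V\times L^2(0,\ell;\mathbb C)\times\mathbb C^2$ be the Hilbert space of elements $U=(u,v,V)$, $V=(w,z)$, with the norm $$\|U\|_{\mathcal H}^2=\int_0^\ell\big(|v|^2+\alpha|u_{xx}|^2\big)\,dx+BV\cdot \overline V .$$ On the domain $$D(\mathcal A)=D(\mathcal A_0)=\{U\in\mathcal H:\ u\in H^4(0,\ell),\ v\in\mathcal V,\ w=v(0),\ z=v_x(0)\}$$ define the conservative and the damped hybrid beam operators $$\mathcal A_0U=\big(v,\,-\alpha u_{xxxx},\,B^{-1}\Gamma(u)\big),\qquad \mathcal AU=\mathcal A_0U-\big(0,0,B^{-1}KV\big).$$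 Then each operator $A\in\{\mathcal A,\mathcal A_0\}$ is the infinitesimal generator of a strongly continuous semigroup of contractions $(S(t))_{t\ge0}$ on $\mathcal H$. Moreover, for every $T>0$ and every $U_0\in\mathcal H$, the problem $U_t=AU$, $U(0)=U_0$ has a mild solution on $[0,T]$, that is, an integrable $U:[0,T]\to\mathcal H$ such that $\int_0^tU(s)\,ds\in D(A)$ and $U(t)=U_0+A\int_0^tU(s)\,ds$ for all $t\in[0,T]$; every mild solution satisfies $U(t)=S(t)U_0$ on $[0,T]$ (so it is unique) and belongs to $C([0,T];\mathcal H)$. If in addition $U_0\in D(A)$, then this solution satisfies $U(0)=U_0$ and $U_t(t)=AU(t)$ for all $t\in[0,T]$, and $$U\in C([0,T];D(A))\cap C^1([0,T];\mathcal H),$$ where $D(A)$ carries the graph norm. -/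

import Mathlib

open MeasureTheory Set Filter Topology
open scoped ContDiff Matrix

noncomputable section

namespace HybridBeam

/-! ## Sobolev spaces on the interval `(0, ℓ)` -/

/-- The complex space `L²(0, ℓ)`. -/
abbrev L2 (ℓ : ℝ) : Type := Lp ℂ 2 (volume.restrict (Ioo (0 : ℝ) ℓ))

/-- Real-valued test functions of class `C_c^∞(0, ℓ)`. -/
structure IsTest (ℓ : ℝ) (φ : ℝ → ℝ) : Prop where
  smooth : ContDiff ℝ ∞ φ
  compact : HasCompactSupport φ
  supp : tsupport φ ⊆ Ioo 0 ℓ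

/-- `g ∈ L²(0, ℓ)` is the weak (distributional) derivative of `f ∈ L²(0, ℓ)`. -/
def IsWeakDeriv (ℓ : ℝ) (f g : L2 ℓ) : Prop :=
  ∀ φ : ℝ → ℝ, IsTest ℓ φ →
    ∫ x in Ioo 0 ℓ, deriv φ x • f x = - ∫ x in Ioo 0 ℓ, φ x • g x

open Classical in
/-- The weak derivative of `f`, if it exists in `L²(0, ℓ)` (and `0` otherwise). -/
def wderiv {ℓ : ℝ} (f : L2 ℓ) : L2 ℓ :=
  if h : ∃ g, IsWeakDeriv ℓ f g then h.choose else 0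

/-- `f ∈ H^k(0, ℓ)`: the weak derivatives of `f` up to order `k` exist in `L²(0, ℓ)`. -/
def MemH {ℓ : ℝ} : ℕ → L2 ℓ → Prop
  | 0, _ => True
  | k + 1, f => ∃ g, IsWeakDeriv ℓ f g ∧ MemH k g

open Classical in
/-- The value at `x ∈ [0, ℓ]` of the representative of `f` that is continuous on `[0, ℓ]`
(and `0` if there is none; functions in `H^1(0, ℓ)` have one). -/
def trace {ℓ : ℝ} (f : L2 ℓ) (x : ℝ) : ℂ :=
  if h : ∃ g : ℝ → ℂ, ContinuousOn g (Icc 0 ℓ) ∧ f =ᵐ[volume.restrict (Ioo 0 ℓ)] g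
  then h.choose x else 0

lemma intOn {ℓ : ℝ} (f : L2 ℓ) : IntegrableOn f (Ioo 0 ℓ) :=
  (Lp.memLp f).integrable (by norm_num)

lemma IsTest.deriv_bdd {ℓ : ℝ} {φ : ℝ → ℝ} (h : IsTest ℓ φ) : ∃ C, ∀ x, ‖deriv φ x‖ ≤ C :=
  h.compact.deriv.exists_bound_of_continuous (h.smooth.continuous_deriv (by simp))

lemma IsTest.int_smul {ℓ : ℝ} {φ : ℝ → ℝ} (h : IsTest ℓ φ) {f : ℝ → ℂ}
    (hf : IntegrableOn f (Ioo 0 ℓ)) :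
    IntegrableOn (fun x => φ x • f x) (Ioo 0 ℓ) := by
  obtain ⟨C, hC⟩ := h.compact.exists_bound_of_continuous h.smooth.continuous
  exact Integrable.bdd_smul hf C h.smooth.continuous.aestronglyMeasurable (ae_of_all _ hC)

lemma IsTest.int_deriv_smul {ℓ : ℝ} {φ : ℝ → ℝ} (h : IsTest ℓ φ) {f : ℝ → ℂ}
    (hf : IntegrableOn f (Ioo 0 ℓ)) :
    IntegrableOn (fun x => deriv φ x • f x) (Ioo 0 ℓ) := by
  obtain ⟨C, hC⟩ := h.deriv_bdd
  exact Integrable.bdd_smul hf C (h.smooth.continuous_deriv (by simp)).aestronglyMeasurable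
    (ae_of_all _ hC)

lemma ae_zero_of_test {ℓ : ℝ} {f : ℝ → ℂ} (hf : IntegrableOn f (Ioo 0 ℓ))
    (h : ∀ φ, IsTest ℓ φ → ∫ x in Ioo 0 ℓ, φ x • f x = 0) :
    f =ᵐ[volume.restrict (Ioo 0 ℓ)] 0 := by
  have := isOpen_Ioo.ae_eq_zero_of_integral_contDiff_smul_eq_zero (μ := volume) (U := Ioo 0 ℓ)
    hf.locallyIntegrableOn (fun φ h1 h2 h3 => by
      rw [← h φ ⟨h1, h2, h3⟩]
      symm
      apply setIntegral_eq_integral_of_forall_compl_eq_zero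
      intro x hx
      rw [image_eq_zero_of_notMem_tsupport (fun hx' => hx (h3 hx')), zero_smul])
  exact (ae_restrict_iff' measurableSet_Ioo).2 this

lemma IsWeakDeriv.unique {ℓ : ℝ} {f g₁ g₂ : L2 ℓ} (h₁ : IsWeakDeriv ℓ f g₁)
    (h₂ : IsWeakDeriv ℓ f g₂) : g₁ = g₂ := by
  rw [← sub_eq_zero, Lp.eq_zero_iff_ae_eq_zero]
  refine ae_zero_of_test (intOn _) fun φ hφ => ?_
  have e : ∫ x in Ioo 0 ℓ, φ x • (g₁ - g₂) x = ∫ x in Ioo 0 ℓ, (φ x • g₁ x - φ x • g₂ x) := by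
    apply integral_congr_ae
    filter_upwards [Lp.coeFn_sub g₁ g₂] with x hx
    rw [hx, Pi.sub_apply, smul_sub]
  rw [e, integral_sub (hφ.int_smul (intOn _)) (hφ.int_smul (intOn _)),
    neg_injective ((h₁ φ hφ).symm.trans (h₂ φ hφ)), sub_self]

lemma IsWeakDeriv.add {ℓ : ℝ} {f₁ f₂ g₁ g₂ : L2 ℓ} (h₁ : IsWeakDeriv ℓ f₁ g₁)
    (h₂ : IsWeakDeriv ℓ f₂ g₂) : IsWeakDeriv ℓ (f₁ + f₂) (g₁ + g₂) := by
  intro φ hφ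
  have e1 : ∫ x in Ioo 0 ℓ, deriv φ x • (f₁ + f₂) x
      = ∫ x in Ioo 0 ℓ, (deriv φ x • f₁ x + deriv φ x • f₂ x) := by
    apply integral_congr_ae
    filter_upwards [Lp.coeFn_add f₁ f₂] with x hx
    rw [hx, Pi.add_apply, smul_add]
  have e2 : ∫ x in Ioo 0 ℓ, φ x • (g₁ + g₂) x
      = ∫ x in Ioo 0 ℓ, (φ x • g₁ x + φ x • g₂ x) := by
    apply integral_congr_ae
    filter_upwards [Lp.coeFn_add g₁ g₂] with x hx
    rw [hx, Pi.add_apply, smul_add]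
  rw [e1, e2, integral_add (hφ.int_deriv_smul (intOn _)) (hφ.int_deriv_smul (intOn _)),
    integral_add (hφ.int_smul (intOn _)) (hφ.int_smul (intOn _)), h₁ φ hφ, h₂ φ hφ, neg_add]

lemma IsWeakDeriv.smul {ℓ : ℝ} {f g : L2 ℓ} (c : ℂ) (h : IsWeakDeriv ℓ f g) :
    IsWeakDeriv ℓ (c • f) (c • g) := by
  intro φ hφ
  have e1 : ∫ x in Ioo 0 ℓ, deriv φ x • (c • f) x
      = ∫ x in Ioo 0 ℓ, c • (deriv φ x • f x) := by
    apply integral_congr_ae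
    filter_upwards [Lp.coeFn_smul c f] with x hx
    rw [hx, Pi.smul_apply, smul_comm]
  have e2 : ∫ x in Ioo 0 ℓ, φ x • (c • g) x = ∫ x in Ioo 0 ℓ, c • (φ x • g x) := by
    apply integral_congr_ae
    filter_upwards [Lp.coeFn_smul c g] with x hx
    rw [hx, Pi.smul_apply, smul_comm]
  rw [e1, e2, integral_smul, integral_smul, h φ hφ, smul_neg]

lemma IsWeakDeriv.zero (ℓ : ℝ) : IsWeakDeriv ℓ 0 0 := by
  simpa using IsWeakDeriv.smul (ℓ := ℓ) (f := 0) (g := 0) 0 (by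
    intro φ hφ
    have e : ∀ ψ : ℝ → ℝ, ∫ x in Ioo 0 ℓ, ψ x • (0 : L2 ℓ) x = 0 := by
      intro ψ
      apply integral_eq_zero_of_ae
      filter_upwards [Lp.coeFn_zero ℂ 2 (volume.restrict (Ioo (0 : ℝ) ℓ))] with x hx
      rw [hx]; simp
    rw [e, e, neg_zero])

lemma IsWeakDeriv.wderiv_eq {ℓ : ℝ} {f g : L2 ℓ} (h : IsWeakDeriv ℓ f g) : wderiv f = g := by
  have hex : ∃ g, IsWeakDeriv ℓ f g := ⟨g, h⟩
  rw [wderiv, dif_pos hex]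
  exact hex.choose_spec.unique h

lemma MemH.isWeakDeriv {ℓ : ℝ} {k : ℕ} {f : L2 ℓ} (h : MemH (k + 1) f) :
    IsWeakDeriv ℓ f (wderiv f) := by
  obtain ⟨g, hg, -⟩ := h
  rwa [hg.wderiv_eq]

lemma MemH.wderiv_mem {ℓ : ℝ} {k : ℕ} {f : L2 ℓ} (h : MemH (k + 1) f) : MemH k (wderiv f) := by
  obtain ⟨g, hg, hk⟩ := h
  rwa [hg.wderiv_eq]

lemma MemH.of_succ {ℓ : ℝ} {k : ℕ} {f : L2 ℓ} (h : MemH (k + 1) f) : MemH k f := by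
  induction k generalizing f with
  | zero => trivial
  | succ k ih =>
    obtain ⟨g, hg, hk⟩ := h
    exact ⟨g, hg, ih hk⟩

lemma MemH.one {ℓ : ℝ} {k : ℕ} {f : L2 ℓ} (h : MemH (k + 1) f) : MemH 1 f := by
  obtain ⟨g, hg, -⟩ := h
  exact ⟨g, hg, trivial⟩

lemma MemH.add {ℓ : ℝ} {k : ℕ} {f g : L2 ℓ} (hf : MemH k f) (hg : MemH k g) :
    MemH k (f + g) := by
  induction k generalizing f g with
  | zero => trivial
  | succ k ih =>
    obtain ⟨f', hf', hf⟩ := hf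
    obtain ⟨g', hg', hg⟩ := hg
    exact ⟨f' + g', hf'.add hg', ih hf hg⟩

lemma MemH.smul {ℓ : ℝ} {k : ℕ} {f : L2 ℓ} (c : ℂ) (hf : MemH k f) : MemH k (c • f) := by
  induction k generalizing f with
  | zero => trivial
  | succ k ih =>
    obtain ⟨f', hf', hf⟩ := hf
    exact ⟨c • f', hf'.smul c, ih hf⟩

lemma MemH.zero (ℓ : ℝ) (k : ℕ) : MemH k (0 : L2 ℓ) := by
  induction k with
  | zero => trivial
  | succ k ih => exact ⟨0, IsWeakDeriv.zero ℓ, ih⟩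

lemma wderiv_zero (ℓ : ℝ) : wderiv (0 : L2 ℓ) = 0 := (IsWeakDeriv.zero ℓ).wderiv_eq

lemma wderiv_add {ℓ : ℝ} {f g : L2 ℓ} (hf : MemH 1 f) (hg : MemH 1 g) :
    wderiv (f + g) = wderiv f + wderiv g :=
  (hf.isWeakDeriv.add hg.isWeakDeriv).wderiv_eq

lemma wderiv_smul {ℓ : ℝ} {f : L2 ℓ} (c : ℂ) (hf : MemH 1 f) :
    wderiv (c • f) = c • wderiv f :=
  (hf.isWeakDeriv.smul c).wderiv_eq

lemma trace_eq {ℓ : ℝ} (hℓ : 0 < ℓ) {f : L2 ℓ} {g : ℝ → ℂ} (hg : ContinuousOn g (Icc 0 ℓ))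
    (hfg : f =ᵐ[volume.restrict (Ioo 0 ℓ)] g) {x : ℝ} (hx : x ∈ Icc 0 ℓ) : trace f x = g x := by
  have hex : ∃ g : ℝ → ℂ, ContinuousOn g (Icc 0 ℓ) ∧ f =ᵐ[volume.restrict (Ioo 0 ℓ)] g :=
    ⟨g, hg, hfg⟩
  rw [trace, dif_pos hex]
  obtain ⟨h1, h2⟩ := hex.choose_spec
  have h3 : hex.choose =ᵐ[volume.restrict (Icc 0 ℓ)] g := by
    rw [← restrict_Ioo_eq_restrict_Icc]
    exact h2.symm.trans hfg
  exact Measure.eqOn_Icc_of_ae_eq volume hℓ.ne h3 h1 hg hx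

lemma IsTest.apply_left {ℓ : ℝ} {φ : ℝ → ℝ} (h : IsTest ℓ φ) {x : ℝ} (hx : x ∉ Ioo 0 ℓ) :
    φ x = 0 :=
  image_eq_zero_of_notMem_tsupport fun hx' => hx (h.supp hx')

lemma primitive_eq {ℓ : ℝ} (g : ℝ → ℂ) {x : ℝ} (hx : x ∈ Ioo 0 ℓ) :
    ∫ t in (0 : ℝ)..x, g t = ∫ t in Ioo 0 ℓ, (Iio x).indicator g t := by
  rw [intervalIntegral.integral_of_le hx.1.le, integral_Ioc_eq_integral_Ioo,
    setIntegral_indicator measurableSet_Iio]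
  congr 2
  ext t
  simp only [mem_Ioo, mem_inter_iff, mem_Iio]
  exact ⟨fun h => ⟨⟨h.1, h.2.trans hx.2⟩, h.2⟩, fun h => ⟨h.1.1, h.2⟩⟩

/-- The primitive of an integrable function satisfies the integration by parts formula. -/
lemma primitive_parts {ℓ : ℝ} {g : ℝ → ℂ} (hg : IntegrableOn g (Ioo 0 ℓ)) {φ : ℝ → ℝ}
    (hφ : IsTest ℓ φ) :
    ∫ x in Ioo 0 ℓ, deriv φ x • ∫ t in (0 : ℝ)..x, g t = - ∫ x in Ioo 0 ℓ, φ x • g x := by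
  have hdc : Continuous (deriv φ) := hφ.smooth.continuous_deriv (by simp)
  have hdi : IntegrableOn (deriv φ) (Ioo 0 ℓ) :=
    (hdc.integrable_of_hasCompactSupport hφ.compact.deriv).integrableOn
  have e1 : ∫ x in Ioo 0 ℓ, deriv φ x • ∫ t in (0 : ℝ)..x, g t
      = ∫ x in Ioo 0 ℓ, ∫ t in Ioo 0 ℓ,
          ({p : ℝ × ℝ | p.2 < p.1}.indicator fun p => deriv φ p.1 • g p.2) (x, t) := by
    refine setIntegral_congr_fun measurableSet_Ioo fun x hx => ?_
    rw [primitive_eq g hx, ← integral_smul]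
    congr 1
    ext t
    by_cases h : t < x <;> simp [indicator, h]
  have hint : Integrable (Function.uncurry fun x t =>
      ({p : ℝ × ℝ | p.2 < p.1}.indicator fun p => deriv φ p.1 • g p.2) (x, t))
      ((volume.restrict (Ioo 0 ℓ)).prod (volume.restrict (Ioo 0 ℓ))) :=
    (Integrable.smul_prod hdi hg).indicator (measurableSet_lt measurable_snd measurable_fst)
  rw [e1, integral_integral_swap hint, ← integral_neg]
  refine setIntegral_congr_fun measurableSet_Ioo fun t ht => ?_
  have e2 : ∀ x, ({p : ℝ × ℝ | p.2 < p.1}.indicator fun p => deriv φ p.1 • g p.2) (x, t)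
      = (Ioi t).indicator (deriv φ) x • g t := by
    intro x
    by_cases h : t < x <;> simp [indicator, h]
  simp only [e2]
  rw [integral_smul_const, setIntegral_indicator measurableSet_Ioi]
  have e3 : Ioo 0 ℓ ∩ Ioi t = Ioo t ℓ := by
    ext x
    simp only [mem_Ioo, mem_inter_iff, mem_Ioi]
    exact ⟨fun h => ⟨h.2, h.1.2⟩, fun h => ⟨⟨ht.1.trans h.1, h.2⟩, h.1⟩⟩
  rw [e3, ← integral_Ioc_eq_integral_Ioo, ← intervalIntegral.integral_of_le ht.2.le,
    intervalIntegral.integral_deriv_eq_sub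
      (fun x _ => (hφ.smooth.differentiable (by simp)).differentiableAt)
      (hdc.intervalIntegrable _ _),
    hφ.apply_left (x := ℓ) (by simp), zero_sub, neg_smul]

/-- A function whose weak derivative vanishes is constant. -/
lemma ae_const {ℓ : ℝ} (hℓ : 0 < ℓ) {f : ℝ → ℂ} (hf : IntegrableOn f (Ioo 0 ℓ))
    (h : ∀ φ, IsTest ℓ φ → ∫ x in Ioo 0 ℓ, deriv φ x • f x = 0) :
    ∃ c : ℂ, f =ᵐ[volume.restrict (Ioo 0 ℓ)] fun _ => c := by
  let β : ContDiffBump (ℓ / 2) := ⟨ℓ / 8, ℓ / 4, by positivity, by linarith⟩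
  let ψ : ℝ → ℝ := β.normed volume
  have hψ : IsTest ℓ ψ := by
    refine ⟨β.contDiff_normed, β.hasCompactSupport_normed, ?_⟩
    rw [β.tsupport_normed_eq, Real.closedBall_eq_Icc]
    intro x hx
    have h1 : ℓ / 2 - ℓ / 4 ≤ x := hx.1
    have h2 : x ≤ ℓ / 2 + ℓ / 4 := hx.2
    constructor <;> linarith
  have hψ1 : ∫ x, ψ x = 1 := β.integral_normed
  refine ⟨∫ x in Ioo 0 ℓ, ψ x • f x, ?_⟩
  set c := ∫ x in Ioo 0 ℓ, ψ x • f x with hc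
  have hci : IntegrableOn (fun _ : ℝ => c) (Ioo 0 ℓ) := by simp
  have key : (fun x => f x - c) =ᵐ[volume.restrict (Ioo 0 ℓ)] 0 := by
    refine ae_zero_of_test (hf.sub hci) fun φ hφ => ?_
    let s : ℝ := ∫ x, φ x
    let η : ℝ → ℝ := fun x => φ x - s * ψ x
    have hηs : ContDiff ℝ ∞ η := hφ.smooth.sub (contDiff_const.mul hψ.smooth)
    have hη0 : ∫ x, η x = 0 := by
      have h1 : Integrable φ := hφ.smooth.continuous.integrable_of_hasCompactSupport hφ.compact
      have h2 : Integrable ψ := hψ.smooth.continuous.integrable_of_hasCompactSupport hψ.compact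
      simp only [η]
      rw [integral_sub h1 (h2.const_mul s), integral_const_mul, hψ1, mul_one, sub_self]
    obtain ⟨a, b, ha, hb, hab⟩ : ∃ a b, 0 < a ∧ b < ℓ ∧ ∀ x, x ∉ Icc a b → η x = 0 := by
      have hK : IsCompact (tsupport φ ∪ tsupport ψ) := hφ.compact.isCompact.union hψ.compact.isCompact
      have hKs : tsupport φ ∪ tsupport ψ ⊆ Ioo 0 ℓ := union_subset hφ.supp hψ.supp
      have hKn : (tsupport φ ∪ tsupport ψ).Nonempty := by
        refine Nonempty.inr ?_
        by_contra hne
        rw [not_nonempty_iff_eq_empty, tsupport_eq_empty_iff] at hne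
        rw [hne] at hψ1
        simp at hψ1
      refine ⟨_, _, (hKs (hK.sInf_mem hKn)).1, (hKs (hK.sSup_mem hKn)).2, fun x hx => ?_⟩
      have hx' : x ∉ tsupport φ ∪ tsupport ψ := fun h' =>
        hx ⟨csInf_le hK.bddBelow h', le_csSup hK.bddAbove h'⟩
      rw [mem_union, not_or] at hx'
      simp only [η]
      rw [image_eq_zero_of_notMem_tsupport hx'.1, image_eq_zero_of_notMem_tsupport hx'.2]
      simp
    let Φ : ℝ → ℝ := fun x => ∫ t in (0 : ℝ)..x, η t
    have hd : ∀ x, HasDerivAt Φ (η x) x := fun x =>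
      intervalIntegral.integral_hasDerivAt_right (hηs.continuous.intervalIntegrable _ _)
        (hηs.continuous.stronglyMeasurableAtFilter _ _) hηs.continuous.continuousAt
    have hdΦ : deriv Φ = η := funext fun x => (hd x).deriv
    have hΦ0 : ∀ x, x ∉ Icc a b → Φ x = 0 := by
      intro x hx
      rcases lt_or_ge x a with hxa | hxa
      · refine (intervalIntegral.integral_congr (g := fun _ => 0) fun t ht => ?_).trans (by simp)
        refine hab t fun h' => ?_
        rcases mem_uIcc.1 ht with h1 | h1 <;> linarith [h'.1, h1.1, h1.2]
      · have hxb : b < x := by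
          by_contra hle
          exact hx ⟨hxa, not_lt.1 hle⟩
        have h0x : 0 ≤ x := (ha.trans_le hxa).le
        simp only [Φ]
        rw [intervalIntegral.integral_of_le h0x]
        refine Eq.trans ?_ hη0
        refine setIntegral_eq_integral_of_forall_compl_eq_zero fun t ht => hab t fun h' => ht ?_
        exact ⟨ha.trans_le h'.1, h'.2.trans hxb.le⟩
    have htΦ : tsupport Φ ⊆ Icc a b :=
      closure_minimal (fun x hx => by by_contra h'; exact hx (hΦ0 x h')) isClosed_Icc
    have hΦ : IsTest ℓ Φ := by
      refine ⟨contDiff_infty_iff_deriv.2 ⟨fun x => (hd x).differentiableAt, hdΦ ▸ hηs⟩,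
        isCompact_Icc.of_isClosed_subset (isClosed_tsupport _) htΦ, fun x hx => ?_⟩
      exact ⟨ha.trans_le (htΦ hx).1, (htΦ hx).2.trans_lt hb⟩
    have h1 := h Φ hΦ
    rw [hdΦ] at h1
    have e1 : ∫ x in Ioo 0 ℓ, η x • f x
        = (∫ x in Ioo 0 ℓ, φ x • f x) - s • c := by
      have hi : IntegrableOn (fun x => s • (ψ x • f x)) (Ioo 0 ℓ) := (hψ.int_smul hf).smul s
      rw [hc, ← integral_smul, ← integral_sub (hφ.int_smul hf) hi]
      congr 1
      ext x
      simp only [η, sub_smul, mul_smul]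
    have e2 : ∫ x in Ioo 0 ℓ, φ x • c = s • c := by
      rw [integral_smul_const]
      congr 1
      exact setIntegral_eq_integral_of_forall_compl_eq_zero fun x hx => hφ.apply_left hx
    simp only [smul_sub]
    rw [integral_sub (hφ.int_smul hf) (hφ.int_smul hci), e2, ← e1, h1]
  filter_upwards [key] with x hx
  exact sub_eq_zero.1 hx

lemma primitive_cont {ℓ : ℝ} (hℓ : 0 < ℓ) {g : ℝ → ℂ} (hg : IntegrableOn g (Ioo 0 ℓ)) :
    ContinuousOn (fun x => ∫ t in (0 : ℝ)..x, g t) (Icc 0 ℓ) := by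
  have := intervalIntegral.continuousOn_primitive_interval (a := 0) (b := ℓ) (f := g)
    (μ := volume) (by rw [uIcc_of_le hℓ.le]; exact (integrableOn_Icc_iff_integrableOn_Ioo).2 hg)
  rwa [uIcc_of_le hℓ.le] at this

lemma MemH.exists_rep {ℓ : ℝ} (hℓ : 0 < ℓ) {f : L2 ℓ} (h : MemH 1 f) :
    ∃ g : ℝ → ℂ, ContinuousOn g (Icc 0 ℓ) ∧ f =ᵐ[volume.restrict (Ioo 0 ℓ)] g := by
  have hw := h.isWeakDeriv
  have hc := primitive_cont hℓ (intOn (wderiv f))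
  have hi : IntegrableOn (fun x => ∫ t in (0 : ℝ)..x, wderiv f t) (Ioo 0 ℓ) :=
    hc.integrableOn_Icc.mono_set Ioo_subset_Icc_self
  obtain ⟨c, hcc⟩ := ae_const hℓ (f := fun x => f x - ∫ t in (0 : ℝ)..x, wderiv f t)
    ((intOn f).sub hi) (fun φ hφ => by
      simp only [smul_sub]
      rw [integral_sub (hφ.int_deriv_smul (intOn f)) (hφ.int_deriv_smul hi), hw φ hφ,
        primitive_parts (intOn _) hφ, sub_self])
  refine ⟨fun x => c + ∫ t in (0 : ℝ)..x, wderiv f t, continuousOn_const.add hc, ?_⟩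
  filter_upwards [hcc] with x hx
  rw [← hx]; ring

lemma trace_add {ℓ : ℝ} (hℓ : 0 < ℓ) {f g : L2 ℓ} (hf : MemH 1 f) (hg : MemH 1 g) {x : ℝ}
    (hx : x ∈ Icc 0 ℓ) : trace (f + g) x = trace f x + trace g x := by
  obtain ⟨f', hf1, hf2⟩ := hf.exists_rep hℓ
  obtain ⟨g', hg1, hg2⟩ := hg.exists_rep hℓ
  rw [trace_eq hℓ hf1 hf2 hx, trace_eq hℓ hg1 hg2 hx]
  exact trace_eq hℓ (hf1.add hg1) ((Lp.coeFn_add f g).trans (hf2.add hg2)) hx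

lemma trace_smul {ℓ : ℝ} (hℓ : 0 < ℓ) {f : L2 ℓ} (c : ℂ) (hf : MemH 1 f) {x : ℝ}
    (hx : x ∈ Icc 0 ℓ) : trace (c • f) x = c * trace f x := by
  obtain ⟨f', hf1, hf2⟩ := hf.exists_rep hℓ
  rw [trace_eq hℓ hf1 hf2 hx]
  exact trace_eq hℓ (hf1.const_smul c) ((Lp.coeFn_smul c f).trans (hf2.const_smul c)) hx

lemma trace_zero {ℓ : ℝ} (hℓ : 0 < ℓ) {x : ℝ} (hx : x ∈ Icc 0 ℓ) : trace (0 : L2 ℓ) x = 0 :=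
  trace_eq hℓ (g := 0) continuousOn_const (Lp.coeFn_zero _ _ _) hx

/-- A function with vanishing weak derivative and vanishing trace at `ℓ` vanishes. -/
lemma eq_zero_of_wderiv {ℓ : ℝ} (hℓ : 0 < ℓ) {f : L2 ℓ} (hf : MemH 1 f) (h : wderiv f = 0)
    (ht : trace f ℓ = 0) : f = 0 := by
  have hw := hf.isWeakDeriv
  rw [h] at hw
  obtain ⟨c, hc⟩ := ae_const hℓ (intOn f) (fun φ hφ => by
    rw [hw φ hφ, neg_eq_zero]
    apply integral_eq_zero_of_ae
    filter_upwards [Lp.coeFn_zero ℂ 2 (volume.restrict (Ioo (0 : ℝ) ℓ))] with x hx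
    rw [hx]; simp)
  rw [trace_eq hℓ continuousOn_const hc (right_mem_Icc.2 hℓ.le)] at ht
  rw [Lp.eq_zero_iff_ae_eq_zero]
  filter_upwards [hc] with x hx
  rw [hx, ht]; rfl

lemma exists_primitive {ℓ : ℝ} (hℓ : 0 < ℓ) (g : L2 ℓ) :
    ∃ f : L2 ℓ, IsWeakDeriv ℓ f g ∧ trace f ℓ = 0 := by
  have hc := primitive_cont hℓ (intOn g)
  let G : ℝ → ℂ := fun x => (∫ t in (0 : ℝ)..x, g t) - ∫ t in (0 : ℝ)..ℓ, g t
  have hG : ContinuousOn G (Icc 0 ℓ) := hc.sub continuousOn_const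
  have hGm : MemLp G 2 (volume.restrict (Ioo 0 ℓ)) := by
    obtain ⟨C, hC⟩ := isCompact_Icc.exists_bound_of_continuousOn hG
    refine MemLp.of_bound
      ((hG.mono Ioo_subset_Icc_self).aestronglyMeasurable measurableSet_Ioo) C ?_
    exact (ae_restrict_iff' measurableSet_Ioo).2
      (ae_of_all _ fun x hx => hC x (Ioo_subset_Icc_self hx))
  refine ⟨hGm.toLp G, fun φ hφ => ?_, ?_⟩
  · have hi : IntegrableOn (fun x => ∫ t in (0 : ℝ)..x, g t) (Ioo 0 ℓ) :=
      hc.integrableOn_Icc.mono_set Ioo_subset_Icc_self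
    have hdc : Continuous (deriv φ) := hφ.smooth.continuous_deriv (by simp)
    have e0 : ∫ x in Ioo 0 ℓ, deriv φ x = 0 := by
      rw [← integral_Ioc_eq_integral_Ioo, ← intervalIntegral.integral_of_le hℓ.le,
        intervalIntegral.integral_deriv_eq_sub
          (fun x _ => (hφ.smooth.differentiable (by simp)).differentiableAt)
          (hdc.intervalIntegrable _ _), hφ.apply_left (x := ℓ) (by simp),
        hφ.apply_left (x := 0) (by simp), sub_self]
    have e1 : ∫ x in Ioo 0 ℓ, deriv φ x • (hGm.toLp G) x
        = ∫ x in Ioo 0 ℓ, (deriv φ x • (∫ t in (0 : ℝ)..x, g t)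
            - deriv φ x • ∫ t in (0 : ℝ)..ℓ, g t) := by
      apply integral_congr_ae
      filter_upwards [hGm.coeFn_toLp] with x hx
      rw [hx, ← smul_sub]
    rw [e1, integral_sub (hφ.int_deriv_smul hi) (hφ.int_deriv_smul (by simp)),
      integral_smul_const, e0, zero_smul, sub_zero, primitive_parts (intOn g) hφ]
  · rw [trace_eq hℓ hG hGm.coeFn_toLp (right_mem_Icc.2 hℓ.le)]
    exact sub_self _

/-! ## The phase space -/

/-- The physical parameters of the beam: length `ℓ`, stiffness `α`, mass `m` and moment of
inertia `J` of the tip body, distance `d` from its centre of mass to the end of the beam, and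
damping coefficients `γ`, `γs`. -/
structure Beam where
  ℓ : ℝ
  α : ℝ
  m : ℝ
  J : ℝ
  d : ℝ
  γ : ℝ
  γs : ℝ
  ℓ_pos : 0 < ℓ
  α_pos : 0 < α
  m_pos : 0 < m
  J_pos : 0 < J

variable (p : Beam)

/-- `𝒱 = {g ∈ H²(0, ℓ) : g(ℓ) = g_x(ℓ) = 0}`. -/
def clamped : Submodule ℂ (L2 p.ℓ) where
  carrier := {g | MemH 2 g ∧ trace g p.ℓ = 0 ∧ trace (wderiv g) p.ℓ = 0}
  zero_mem' := by
    have hx : p.ℓ ∈ Icc 0 p.ℓ := right_mem_Icc.2 p.ℓ_pos.le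
    refine ⟨MemH.zero _ _, trace_zero p.ℓ_pos hx, ?_⟩
    rw [wderiv_zero, trace_zero p.ℓ_pos hx]
  add_mem' := by
    rintro f g ⟨hf, hf1, hf2⟩ ⟨hg, hg1, hg2⟩
    have hx : p.ℓ ∈ Icc 0 p.ℓ := right_mem_Icc.2 p.ℓ_pos.le
    refine ⟨hf.add hg, ?_, ?_⟩
    · rw [trace_add p.ℓ_pos hf.one hg.one hx, hf1, hg1, add_zero]
    · rw [wderiv_add hf.one hg.one, trace_add p.ℓ_pos hf.wderiv_mem hg.wderiv_mem hx, hf2, hg2,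
        add_zero]
  smul_mem' := by
    rintro c f ⟨hf, hf1, hf2⟩
    have hx : p.ℓ ∈ Icc 0 p.ℓ := right_mem_Icc.2 p.ℓ_pos.le
    refine ⟨hf.smul c, ?_, ?_⟩
    · rw [trace_smul p.ℓ_pos c hf.one hx, hf1, mul_zero]
    · rw [wderiv_smul c hf.one, trace_smul p.ℓ_pos c hf.wderiv_mem hx, hf2, mul_zero]

/-- The inertia matrix. -/
def matB : Matrix (Fin 2) (Fin 2) ℂ :=
  !![(p.m : ℂ), p.m * p.d; p.m * p.d, p.J + p.m * p.d ^ 2]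

/-- The damping matrix. -/
def matK : Matrix (Fin 2) (Fin 2) ℂ :=
  !![(p.γ : ℂ), 0; p.d * p.γ, p.d * p.γs]

/-- The phase space `ℋ = 𝒱 × L²(0, ℓ) × ℂ²`, with elements `U = (u, v, V)`, `V = (w, z)`. -/
def PhaseSpace : Type := clamped p × L2 p.ℓ × (Fin 2 → ℂ)

namespace PhaseSpace

variable {p}

instance : AddCommGroup (PhaseSpace p) :=
  inferInstanceAs (AddCommGroup (clamped p × L2 p.ℓ × (Fin 2 → ℂ)))

instance : Module ℂ (PhaseSpace p) :=
  inferInstanceAs (Module ℂ (clamped p × L2 p.ℓ × (Fin 2 → ℂ)))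

/-- The displacement `u ∈ 𝒱`, as an element of `L²(0, ℓ)`. -/
def u : PhaseSpace p →ₗ[ℂ] L2 p.ℓ :=
  (clamped p).subtype ∘ₗ LinearMap.fst ℂ (clamped p) (L2 p.ℓ × (Fin 2 → ℂ))

/-- The velocity `v ∈ L²(0, ℓ)`. -/
def v : PhaseSpace p →ₗ[ℂ] L2 p.ℓ :=
  LinearMap.fst ℂ (L2 p.ℓ) (Fin 2 → ℂ) ∘ₗ LinearMap.snd ℂ (clamped p) (L2 p.ℓ × (Fin 2 → ℂ))

/-- The boundary variables `V = (w, z) ∈ ℂ²`. -/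
def V : PhaseSpace p →ₗ[ℂ] (Fin 2 → ℂ) :=
  LinearMap.snd ℂ (L2 p.ℓ) (Fin 2 → ℂ) ∘ₗ LinearMap.snd ℂ (clamped p) (L2 p.ℓ × (Fin 2 → ℂ))

/-- The state with components `u`, `v`, `V`. -/
def mk (u : clamped p) (v : L2 p.ℓ) (V : Fin 2 → ℂ) : PhaseSpace p := (u, v, V)

@[simp] lemma u_mk (u : clamped p) (v : L2 p.ℓ) (V : Fin 2 → ℂ) : (mk u v V).u = u := rfl
@[simp] lemma v_mk (u : clamped p) (v : L2 p.ℓ) (V : Fin 2 → ℂ) : (mk u v V).v = v := rfl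
@[simp] lemma V_mk (u : clamped p) (v : L2 p.ℓ) (V : Fin 2 → ℂ) : (mk u v V).V = V := rfl

lemma u_mem (U : PhaseSpace p) : U.u ∈ clamped p := U.1.2

lemma ext {U W : PhaseSpace p} (h1 : U.u = W.u) (h2 : U.v = W.v) (h3 : U.V = W.V) : U = W :=
  Prod.ext (Subtype.ext h1) (Prod.ext h2 h3)

/-- `u ↦ u_xx` as a linear map on the phase space. -/
def uxx : PhaseSpace p →ₗ[ℂ] L2 p.ℓ where
  toFun U := wderiv (wderiv U.u)
  map_add' U W := by
    rw [map_add, wderiv_add U.u_mem.1.one W.u_mem.1.one,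
      wderiv_add U.u_mem.1.wderiv_mem W.u_mem.1.wderiv_mem]
  map_smul' c U := by
    rw [map_smul, wderiv_smul c U.u_mem.1.one, wderiv_smul c U.u_mem.1.wderiv_mem]
    rfl

lemma u_eq_zero {U : PhaseSpace p} (h : U.uxx = 0) : U.u = 0 := by
  obtain ⟨h1, h2, h3⟩ := U.u_mem
  exact eq_zero_of_wderiv p.ℓ_pos h1.one (eq_zero_of_wderiv p.ℓ_pos h1.wderiv_mem h h3) h2

/-- The energy inner product (conjugate linear in the first argument)
`∫ (v₁̄ v₂ + α u₁ₓₓ̄ u₂ₓₓ) + V₁̄ ⬝ B V₂`. -/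
def energyInner (U W : PhaseSpace p) : ℂ :=
  inner ℂ U.v W.v + p.α * inner ℂ U.uxx W.uxx + star U.V ⬝ᵥ (matB p *ᵥ W.V)

lemma formB (x y : Fin 2 → ℂ) : star x ⬝ᵥ (matB p *ᵥ y) =
    p.m * (star (x 0 + p.d * x 1) * (y 0 + p.d * y 1)) + p.J * (star (x 1) * y 1) := by
  simp [matB, dotProduct, Matrix.mulVec, Fin.sum_univ_two]
  ring

lemma formB_self (x : Fin 2 → ℂ) : star x ⬝ᵥ (matB p *ᵥ x) =
    ((p.m * ‖x 0 + p.d * x 1‖ ^ 2 + p.J * ‖x 1‖ ^ 2 : ℝ) : ℂ) := by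
  rw [formB]
  push_cast
  rw [← Complex.conj_mul', ← Complex.conj_mul']
  rfl

lemma energyInner_self (U : PhaseSpace p) : energyInner U U =
    ((‖U.v‖ ^ 2 + p.α * ‖U.uxx‖ ^ 2 + (p.m * ‖U.V 0 + p.d * U.V 1‖ ^ 2 + p.J * ‖U.V 1‖ ^ 2) : ℝ)
      : ℂ) := by
  rw [energyInner, formB_self, inner_self_eq_norm_sq_to_K, inner_self_eq_norm_sq_to_K]
  push_cast
  rfl

/-- The energy inner product is an inner product. -/
@[reducible] def core : InnerProductSpace.Core ℂ (PhaseSpace p) where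
  inner := energyInner
  conj_inner_symm U W := by
    simp only [energyInner, formB, map_add, map_mul, Complex.conj_ofReal, inner_conj_symm,
      Complex.star_def, Complex.conj_conj]
    ring
  re_inner_nonneg U := by
    have h := p.α_pos
    have h := p.m_pos
    have h := p.J_pos
    rw [energyInner_self]
    simp only [Complex.ofReal_re, RCLike.re_to_complex]
    positivity
  add_left U W X := by
    simp only [energyInner, map_add, inner_add_left, star_add, add_dotProduct]
    ring
  smul_left U W c := by
    simp only [energyInner, map_smul, inner_smul_left, star_smul, smul_dotProduct, smul_eq_mul,
      Complex.star_def]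
    ring
  definite U h := by
    have h1 := p.α_pos
    have h2 := p.m_pos
    have h3 := p.J_pos
    rw [energyInner_self, Complex.ofReal_eq_zero] at h
    have a1 : 0 ≤ ‖U.v‖ ^ 2 := by positivity
    have a2 : 0 ≤ p.α * ‖U.uxx‖ ^ 2 := by positivity
    have a3 : 0 ≤ p.m * ‖U.V 0 + p.d * U.V 1‖ ^ 2 := by positivity
    have a4 : 0 ≤ p.J * ‖U.V 1‖ ^ 2 := by positivity
    have b1 : ‖U.v‖ ^ 2 = 0 := by linarith
    have b2 : p.α * ‖U.uxx‖ ^ 2 = 0 := by linarith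
    have b3 : p.m * ‖U.V 0 + p.d * U.V 1‖ ^ 2 = 0 := by linarith
    have b4 : p.J * ‖U.V 1‖ ^ 2 = 0 := by linarith
    simp only [mul_eq_zero, h1.ne', h2.ne', h3.ne', false_or, pow_eq_zero_iff, ne_eq,
      OfNat.ofNat_ne_zero, not_false_eq_true, norm_eq_zero] at b1 b2 b3 b4
    rw [b4, mul_zero, add_zero] at b3
    refine ext (by rw [u_eq_zero b2, map_zero]) (by rw [b1, map_zero]) ?_
    rw [map_zero]
    ext i
    fin_cases i
    · exact b3
    · exact b4

instance : NormedAddCommGroup (PhaseSpace p) := core.toNormedAddCommGroup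

instance : InnerProductSpace ℂ (PhaseSpace p) := InnerProductSpace.ofCore core.toCore

lemma norm_sq (U : PhaseSpace p) : ‖U‖ ^ 2 =
    ‖U.v‖ ^ 2 + p.α * ‖U.uxx‖ ^ 2 + (p.m * ‖U.V 0 + p.d * U.V 1‖ ^ 2 + p.J * ‖U.V 1‖ ^ 2) := by
  rw [InnerProductSpace.norm_sq_eq_re_inner (𝕜 := ℂ) U]
  change RCLike.re (energyInner U U) = _
  rw [energyInner_self]
  exact Complex.ofReal_re _

lemma exists_uxx_eq (f : L2 p.ℓ) : ∃ u : clamped p, wderiv (wderiv (u : L2 p.ℓ)) = f := by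
  obtain ⟨g, hg, hg0⟩ := exists_primitive p.ℓ_pos f
  obtain ⟨u, hu, hu0⟩ := exists_primitive p.ℓ_pos g
  refine ⟨⟨u, ⟨g, hu, f, hg, trivial⟩, hu0, ?_⟩, ?_⟩
  · rw [hu.wderiv_eq, hg0]
  · rw [hu.wderiv_eq, hg.wderiv_eq]

/-- The phase space is a Hilbert space. -/
instance : CompleteSpace (PhaseSpace p) := by
  have h1 := p.α_pos
  have h2 := p.m_pos
  have h3 := p.J_pos
  refine Metric.complete_of_cauchySeq_tendsto fun U hU => ?_
  -- a linear map bounded by the norm sends the sequence to a Cauchy sequence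
  have aux : ∀ {F : Type} [NormedAddCommGroup F] [NormedSpace ℂ F] (L : PhaseSpace p →ₗ[ℂ] F)
      (c : ℝ), 0 < c → (∀ W, c * ‖L W‖ ^ 2 ≤ ‖W‖ ^ 2) → CauchySeq fun n => L (U n) := by
    intro F _ _ L c hc hL
    refine (L.mkContinuous (Real.sqrt c)⁻¹ fun W => ?_).uniformContinuous.comp_cauchySeq hU
    have hs : 0 < Real.sqrt c := Real.sqrt_pos.2 hc
    rw [inv_mul_eq_div, le_div_iff₀ hs]
    refine abs_le_of_sq_le_sq' ?_ (norm_nonneg _) |>.2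
    rw [mul_pow, Real.sq_sqrt hc.le, mul_comm]
    exact hL W
  have bd : ∀ W : PhaseSpace p, 0 ≤ ‖W.v‖ ^ 2 ∧ 0 ≤ p.α * ‖W.uxx‖ ^ 2 ∧
      0 ≤ p.m * ‖W.V 0 + p.d * W.V 1‖ ^ 2 ∧ 0 ≤ p.J * ‖W.V 1‖ ^ 2 := fun W =>
    ⟨by positivity, by positivity, by positivity, by positivity⟩
  obtain ⟨v, hv⟩ := cauchySeq_tendsto_of_complete (aux PhaseSpace.v 1 one_pos fun W => by
    rw [norm_sq]; linarith [bd W])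
  obtain ⟨f, hf⟩ := cauchySeq_tendsto_of_complete (aux uxx p.α h1 fun W => by
    rw [norm_sq]; linarith [bd W])
  let P1 : (Fin 2 → ℂ) →ₗ[ℂ] ℂ := LinearMap.proj 1
  let P0 : (Fin 2 → ℂ) →ₗ[ℂ] ℂ := LinearMap.proj 0 + (p.d : ℂ) • P1
  obtain ⟨s, hs⟩ := cauchySeq_tendsto_of_complete (aux (P0 ∘ₗ PhaseSpace.V) p.m h2 fun W => by
    rw [norm_sq]
    change p.m * ‖W.V 0 + p.d * W.V 1‖ ^ 2 ≤ _
    linarith [bd W])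
  obtain ⟨z, hz⟩ := cauchySeq_tendsto_of_complete (aux (P1 ∘ₗ PhaseSpace.V) p.J h3 fun W => by
    rw [norm_sq]
    change p.J * ‖W.V 1‖ ^ 2 ≤ _
    linarith [bd W])
  obtain ⟨u, hu⟩ := exists_uxx_eq f
  refine ⟨mk u v ![s - p.d * z, z], ?_⟩
  rw [tendsto_iff_norm_sub_tendsto_zero] at hv hf hs hz ⊢
  have hlim := (((hv.pow 2).add ((hf.pow 2).const_mul p.α)).add
    (((hs.pow 2).const_mul p.m).add ((hz.pow 2).const_mul p.J))).sqrt
  simp only [ne_eq, OfNat.ofNat_ne_zero, not_false_eq_true, zero_pow, mul_zero, add_zero,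
    Real.sqrt_zero] at hlim
  refine hlim.congr fun n => ?_
  rw [← Real.sqrt_sq (norm_nonneg (U n - _)), norm_sq]
  congr 1
  have e1 : (mk u v ![s - p.d * z, z]).uxx = f := hu
  simp only [map_sub, e1, v_mk, V_mk, Pi.sub_apply]
  have e2 : (U n).V 0 - ![s - p.d * z, z] 0 + p.d * ((U n).V 1 - ![s - p.d * z, z] 1)
      = (P0 ∘ₗ PhaseSpace.V) (U n) - s := by
    simp [P0, P1]
    ring
  rw [e2]
  rfl

end PhaseSpace

/-! ## The operators -/

/-- The common domain: `u ∈ H⁴(0, ℓ)`, `v ∈ 𝒱`, `w = v(0)`, `z = v_x(0)`. -/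
def domainA : Submodule ℂ (PhaseSpace p) where
  carrier := {U | MemH 4 U.u ∧ U.v ∈ clamped p ∧ U.V 0 = trace U.v 0 ∧
    U.V 1 = trace (wderiv U.v) 0}
  zero_mem' := by
    have hx : (0 : ℝ) ∈ Icc 0 p.ℓ := left_mem_Icc.2 p.ℓ_pos.le
    refine ⟨?_, ?_, ?_, ?_⟩
    · rw [map_zero]; exact MemH.zero _ _
    · rw [map_zero]; exact zero_mem _
    · rw [map_zero, map_zero, trace_zero p.ℓ_pos hx]; rfl
    · rw [map_zero, map_zero, wderiv_zero, trace_zero p.ℓ_pos hx]; rfl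
  add_mem' := by
    rintro U W ⟨a1, a2, a3, a4⟩ ⟨b1, b2, b3, b4⟩
    have hx : (0 : ℝ) ∈ Icc 0 p.ℓ := left_mem_Icc.2 p.ℓ_pos.le
    refine ⟨?_, ?_, ?_, ?_⟩
    · rw [map_add]; exact a1.add b1
    · rw [map_add]; exact add_mem a2 b2
    · rw [map_add, map_add, trace_add p.ℓ_pos a2.1.one b2.1.one hx, Pi.add_apply, a3, b3]
    · rw [map_add, map_add, wderiv_add a2.1.one b2.1.one,
        trace_add p.ℓ_pos a2.1.wderiv_mem b2.1.wderiv_mem hx, Pi.add_apply, a4, b4]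
  smul_mem' := by
    rintro c U ⟨a1, a2, a3, a4⟩
    have hx : (0 : ℝ) ∈ Icc 0 p.ℓ := left_mem_Icc.2 p.ℓ_pos.le
    refine ⟨?_, ?_, ?_, ?_⟩
    · rw [map_smul]; exact a1.smul c
    · rw [map_smul]; exact Submodule.smul_mem _ c a2
    · rw [map_smul, map_smul, trace_smul p.ℓ_pos c a2.1.one hx, Pi.smul_apply, a3, smul_eq_mul]
    · rw [map_smul, map_smul, wderiv_smul c a2.1.one,
        trace_smul p.ℓ_pos c a2.1.wderiv_mem hx, Pi.smul_apply, a4, smul_eq_mul]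

variable {p} in
/-- The boundary forces `Γ = α (-u_xxx(0), u_xx(0))`. -/
def boundaryForce (u : L2 p.ℓ) : Fin 2 → ℂ :=
  ![-p.α * trace (wderiv (wderiv (wderiv u))) 0, p.α * trace (wderiv (wderiv u)) 0]

/-- The conservative operator `𝒜₀ (u, v, V) = (v, -α u_xxxx, B⁻¹ Γ)`. -/
def opA₀ : PhaseSpace p →ₗ.[ℂ] PhaseSpace p where
  domain := domainA p
  toFun :=
    { toFun := fun U => PhaseSpace.mk ⟨(U : PhaseSpace p).v, U.2.2.1⟩
        (-(p.α : ℂ) • wderiv (wderiv (wderiv (wderiv (U : PhaseSpace p).u))))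
        ((matB p)⁻¹ *ᵥ boundaryForce (U : PhaseSpace p).u)
      map_add' := by
        rintro ⟨U, a, -⟩ ⟨W, b, -⟩
        have hx : (0 : ℝ) ∈ Icc 0 p.ℓ := left_mem_Icc.2 p.ℓ_pos.le
        have a' := a.wderiv_mem
        have b' := b.wderiv_mem
        have a'' := a'.wderiv_mem
        have b'' := b'.wderiv_mem
        refine PhaseSpace.ext ?_ ?_ ?_
        · simp
        · simp only [PhaseSpace.v_mk, Submodule.coe_add, map_add]
          rw [wderiv_add a.one b.one, wderiv_add a'.one b'.one, wderiv_add a''.one b''.one,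
            wderiv_add a''.wderiv_mem b''.wderiv_mem, smul_add]
        · simp only [PhaseSpace.V_mk, Submodule.coe_add, map_add]
          rw [← Matrix.mulVec_add]
          congr 1
          simp only [boundaryForce]
          rw [wderiv_add a.one b.one, wderiv_add a'.one b'.one, wderiv_add a''.one b''.one,
            trace_add p.ℓ_pos a''.one b''.one hx,
            trace_add p.ℓ_pos a''.wderiv_mem b''.wderiv_mem hx]
          ext i
          fin_cases i <;> simp <;> ring
      map_smul' := by
        rintro c ⟨U, a, -⟩
        have hx : (0 : ℝ) ∈ Icc 0 p.ℓ := left_mem_Icc.2 p.ℓ_pos.le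
        have a' := a.wderiv_mem
        have a'' := a'.wderiv_mem
        refine PhaseSpace.ext ?_ ?_ ?_
        · simp
        · simp only [PhaseSpace.v_mk, Submodule.coe_smul, map_smul, RingHom.id_apply]
          rw [wderiv_smul c a.one, wderiv_smul c a'.one, wderiv_smul c a''.one,
            wderiv_smul c a''.wderiv_mem, smul_comm]
        · simp only [PhaseSpace.V_mk, Submodule.coe_smul, map_smul, RingHom.id_apply]
          rw [← Matrix.mulVec_smul]
          congr 1
          simp only [boundaryForce]
          rw [wderiv_smul c a.one, wderiv_smul c a'.one, wderiv_smul c a''.one,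
            trace_smul p.ℓ_pos c a''.one hx, trace_smul p.ℓ_pos c a''.wderiv_mem hx]
          ext i
          fin_cases i <;> simp <;> ring }

/-- The damping operator `B₀ (u, v, V) = (0, 0, B⁻¹ K V)`. -/
def opB₀ : PhaseSpace p →ₗ[ℂ] PhaseSpace p where
  toFun U := PhaseSpace.mk 0 0 ((matB p)⁻¹ *ᵥ (matK p *ᵥ U.V))
  map_add' U W := by
    refine PhaseSpace.ext ?_ ?_ ?_ 
    · simp
    · simp
    · simp only [PhaseSpace.V_mk, map_add, Matrix.mulVec_add]
  map_smul' c U := by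
    refine PhaseSpace.ext ?_ ?_ ?_ 
    · simp
    · simp
    · simp only [PhaseSpace.V_mk, map_smul, Matrix.mulVec_smul, RingHom.id_apply]

/-- The damped hybrid operator `𝒜 = 𝒜₀ - B₀`, with `D(𝒜) = D(𝒜₀)`. -/
def opA : PhaseSpace p →ₗ.[ℂ] PhaseSpace p where
  domain := (opA₀ p).domain
  toFun := (opA₀ p).toFun - opB₀ p ∘ₗ (opA₀ p).domain.subtype

/-! ## Semigroups and solutions of `U' = A U` -/

section Semigroup

variable {H : Type*} [NormedAddCommGroup H] [NormedSpace ℂ H]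

/-- `(S t)_{t ≥ 0}` is a strongly continuous semigroup of contractions. -/
structure IsContractionSemigroup (S : ℝ → H →L[ℂ] H) : Prop where
  zero : S 0 = ContinuousLinearMap.id ℂ H
  add : ∀ s t, 0 ≤ s → 0 ≤ t → S (s + t) = (S s).comp (S t)
  strong_cont : ∀ x, Tendsto (fun t => S t x) (𝓝[>] 0) (𝓝 x)
  contraction : ∀ t, 0 ≤ t → ‖S t‖ ≤ 1

/-- `A` (with exactly its domain) is the infinitesimal generator of `(S t)_{t ≥ 0}`. -/
def IsGenerator (A : H →ₗ.[ℂ] H) (S : ℝ → H →L[ℂ] H) : Prop :=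
  ∀ x y, (x, y) ∈ A.graph ↔ Tendsto (fun t : ℝ => t⁻¹ • (S t x - x)) (𝓝[>] 0) (𝓝 y)

/-- `U` is a mild solution on `[0, T]` of `U' = A U`, `U(0) = U₀`: it is integrable and for every
`t ∈ [0, T]` one has `∫₀ᵗ U ∈ D(A)` and `U(t) = U₀ + A ∫₀ᵗ U`. -/
def IsMildSolution (A : H →ₗ.[ℂ] H) (T : ℝ) (U₀ : H) (U : ℝ → H) : Prop :=
  IntervalIntegrable U volume 0 T ∧
    ∀ t ∈ Icc 0 T, (∫ s in (0 : ℝ)..t, U s, U t - U₀) ∈ A.graph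

/-- `U ∈ C([0, T]; D(A))`, where `D(A)` carries the graph norm. -/
def ContInDomain (A : H →ₗ.[ℂ] H) (T : ℝ) (U : ℝ → H) : Prop :=
  ∃ h : ∀ t : Icc 0 T, U t ∈ A.domain,
    Continuous fun t : Icc 0 T => ((U t, A ⟨U t, h t⟩) : H × H)

/-- `U` satisfies `U' = A U` pointwise on `[0, T]` and `U(0) = U₀`. -/
def IsStrictSolution (A : H →ₗ.[ℂ] H) (T : ℝ) (U₀ : H) (U : ℝ → H) : Prop :=
  U 0 = U₀ ∧ ∀ t ∈ Icc 0 T, ∃ h : U t ∈ A.domain,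
    HasDerivWithinAt U (A ⟨U t, h⟩) (Icc 0 T) t

end Semigroup

end HybridBeam

end

open HybridBeam

/-! The proof is Lumer–Phillips on a Hilbert space, in a form where only two facts about the
operator need checking: `A` is dissipative, and `A` itself (rather than `1 - A`) is onto. The second
hypothesis suits the beam, because solving `A U = W` amounts to integrating a function four times,
whereas the resolvent equation is a coupled boundary value problem.

For the beam, two integrations by parts (`inner_wderiv_four`) turn `⟨U, A U⟩` into a purely
imaginary bulk term, boundary terms at `0` that cancel against `V̄ · Γ(u)`, and `- V̄ · M V`, where
`M` is the damping matrix: `0` for the conservative operator, `K` for the damped one. Thus `Re ⟨U, A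
U⟩ = - Re (V̄ · M V)`, and `matK_accretive` supplies the sign. `IsBeamOp` treats both operators at
once.

In the abstract part, surjectivity and dissipativity give an inverse `R` that is everywhere defined
and dissipative, hence bounded by the closed graph theorem. Its range is dense, and coercivity of
`1/n - R` makes `n - A` onto for every `n > 0`. The Yosida approximations `n (J n - 1)` then
generate contractions whose strong limit is the semigroup. Uniqueness of mild solutions comes from
regularising the integrated difference by the resolvent and observing that its norm cannot grow.
Classical regularity comes from `S t x = x + ∫₀ᵗ S s (A x) ds` on `D(A)`. -/

noncomputable section

namespace HybridBeam

/-! ### Dissipative surjective operators: bounded inverse, dense domain, resolvents. -/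

section Dissipative

variable {H : Type*} [NormedAddCommGroup H] [InnerProductSpace ℂ H]

/-- `Re ⟨x, A x⟩ ≤ 0` for all `x ∈ D(A)`. -/
def Dissipative (A : H →ₗ.[ℂ] H) : Prop :=
  ∀ x y, (x, y) ∈ A.graph → (inner ℂ x y).re ≤ 0

/-- Every element of the space is a value of `A`. -/
def Surj (A : H →ₗ.[ℂ] H) : Prop :=
  ∀ y, ∃ x, (x, y) ∈ A.graph

lemma eq_zero_of_forall_quadratic {a b : ℝ} (h : ∀ t : ℝ, t * a + t ^ 2 * b ≤ 0) : a = 0 := by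
  by_contra ha
  have hs : 0 < a ^ 2 := by positivity
  -- For small `t` the linear term wins; this `t` makes the sum `a² (|b| + 1 + b) / (|b| + 1)²`,
  -- which is positive if `a ≠ 0`.
  have h1 := h (a / (|b| + 1))
  have hb : 0 < |b| + 1 := by positivity
  have e : a / (|b| + 1) * a + (a / (|b| + 1)) ^ 2 * b
      = a ^ 2 / (|b| + 1) ^ 2 * (|b| + 1 + b) := by
    field_simp
  rw [e] at h1
  have h2 : 0 < |b| + 1 + b := by linarith [neg_abs_le b]
  have : 0 < a ^ 2 / (|b| + 1) ^ 2 * (|b| + 1 + b) := by positivity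
  linarith

/-- First-order condition at a zero of the non-positive quadratic form `Re ⟨R x, x⟩`. -/
lemma re_inner_eq_zero {R : H →ₗ[ℂ] H} (hR : ∀ y, (inner ℂ (R y) y).re ≤ 0) (x y : H)
    (hx : (inner ℂ (R x) x).re = 0) :
    (inner ℂ (R x) y).re + (inner ℂ (R y) x).re = 0 := by
  refine eq_zero_of_forall_quadratic (b := (inner ℂ (R y) y).re) fun t => ?_
  have h := hR (x + (t : ℂ) • y)
  simp only [map_add, map_smul, inner_add_left, inner_add_right, inner_smul_left, inner_smul_right,
    Complex.conj_ofReal, Complex.add_re, Complex.re_ofReal_mul, hx] at h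
  linarith [h]

lemma eq_zero_of_forall_re_inner {x : H} (h : ∀ y, (inner ℂ x y).re = 0) : x = 0 := by
  have := h x
  rw [← RCLike.re_to_complex, inner_self_eq_norm_sq] at this
  simpa using this

/-- A null vector `x` can be added, with any real coefficient `c`, to a preimage `z` of any `y`.
Dissipativity then gives `c Re ⟨x, y⟩ + Re ⟨z, y⟩ ≤ 0` for all `c`, which forces `Re ⟨x, y⟩ = 0`. -/
lemma Dissipative.eq_zero_of_graph {A : H →ₗ.[ℂ] H} (hA : Dissipative A) (hs : Surj A) {x : H}
    (hx : (x, 0) ∈ A.graph) : x = 0 := by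
  refine eq_zero_of_forall_re_inner fun y => ?_
  obtain ⟨z, hz⟩ := hs y
  by_contra hc
  have h := hA ((((|(inner ℂ z y).re| + 1) / (inner ℂ x y).re : ℝ) : ℂ) • x + z) y (by
    simpa using A.graph.add_mem (A.graph.smul_mem _ hx) hz)
  rw [inner_add_left, inner_smul_left, Complex.conj_ofReal, Complex.add_re,
    Complex.re_ofReal_mul, div_mul_cancel₀ _ hc] at h
  linarith [neg_abs_le (inner ℂ z y).re]

/-- The inverse of a dissipative surjective operator. -/
lemma Dissipative.exists_inverse {A : H →ₗ.[ℂ] H} (hA : Dissipative A) (hs : Surj A) :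
    ∃ R : H →ₗ[ℂ] H, (∀ y, (R y, y) ∈ A.graph) ∧ ∀ x y, (x, y) ∈ A.graph → R y = x := by
  choose r hr using hs
  have uniq : ∀ x y, (x, y) ∈ A.graph → r y = x := by
    intro x y hxy
    refine sub_eq_zero.1 (hA.eq_zero_of_graph (fun y => ⟨r y, hr y⟩) ?_)
    simpa using A.graph.sub_mem (hr y) hxy
  exact ⟨{ toFun := r
           map_add' := fun x y => uniq _ _ (A.graph.add_mem (hr x) (hr y))
           map_smul' := fun c x => uniq _ _ (A.graph.smul_mem c (hr x)) }, hr, uniq⟩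

variable [CompleteSpace H]

/-- An everywhere defined dissipative operator is bounded. -/
lemma continuous_of_re_inner_nonpos {R : H →ₗ[ℂ] H} (hR : ∀ y, (inner ℂ (R y) y).re ≤ 0) :
    Continuous R := by
  refine R.continuous_of_seq_closed_graph fun u x y hu hTu => ?_
  -- Minty's trick: the monotonicity inequality survives the limit, and testing it at `z = x - t w`
  -- with `t` of either sign identifies `y` with `R x`.
  have key : ∀ z, (inner ℂ (y - R z) (x - z)).re ≤ 0 := by
    intro z
    have h1 : Tendsto (fun n => (inner ℂ (R (u n) - R z) (u n - z)).re) atTop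
        (𝓝 (inner ℂ (y - R z) (x - z)).re) :=
      (Complex.continuous_re.tendsto _).comp ((hTu.sub_const _).inner (hu.sub_const _))
    refine le_of_tendsto' h1 fun n => ?_
    rw [← map_sub]
    exact hR _
  refine sub_eq_zero.1 (eq_zero_of_forall_re_inner fun w => ?_)
  refine eq_zero_of_forall_quadratic (b := (inner ℂ (R w) w).re) fun t => ?_
  have h := key (x - (t : ℂ) • w)
  simp only [map_sub, map_smul] at h
  rw [sub_sub_cancel, ← sub_add, inner_add_left, inner_smul_right, inner_smul_right,
    inner_smul_left, Complex.conj_ofReal, Complex.add_re, Complex.re_ofReal_mul,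
    Complex.re_ofReal_mul, Complex.re_ofReal_mul] at h
  linarith

/-- If `x` is orthogonal to the range of `R = A⁻¹`, then `Re ⟨R x, x⟩ = 0` is an extremal value of a
non-positive form. The first-order condition there gives `R x = 0`, so `x = A 0 = 0`. -/
lemma Dissipative.dense_domain {A : H →ₗ.[ℂ] H} (hA : Dissipative A) (hs : Surj A) :
    Dense (A.domain : Set H) := by
  obtain ⟨R, hR, hR'⟩ := hA.exists_inverse hs
  have hd : ∀ y, (inner ℂ (R y) y).re ≤ 0 := fun y => hA _ _ (hR y)
  rw [Submodule.dense_iff_topologicalClosure_eq_top, Submodule.topologicalClosure_eq_top_iff,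
    Submodule.eq_bot_iff]
  intro x hx
  have hx' : ∀ y, inner ℂ (R y) x = 0 := fun y =>
    hx _ (LinearPMap.mem_domain_of_mem_graph (hR y))
  have h0 : R x = 0 := eq_zero_of_forall_re_inner fun y => by
    have := re_inner_eq_zero hd x y (by rw [hx']; rfl)
    rwa [hx' y, Complex.zero_re, add_zero] at this
  have h1 := hR x
  rw [h0] at h1
  exact A.graph_fst_eq_zero_snd h1 rfl

/-- `n - A` is onto for `n > 0`. -/
lemma Dissipative.exists_resolvent_apply {A : H →ₗ.[ℂ] H} (hA : Dissipative A) (hs : Surj A)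
    {n : ℝ} (hn : 0 < n) (y : H) : ∃ x, (x, (n : ℂ) • (x - y)) ∈ A.graph := by
  obtain ⟨R, hR, hR'⟩ := hA.exists_inverse hs
  have hd : ∀ y, (inner ℂ (R y) y).re ≤ 0 := fun y => hA _ _ (hR y)
  let R' : H →L[ℂ] H := ⟨R, continuous_of_re_inner_nonpos hd⟩
  -- With `x = -R w`, the equation `A x = n (x - y)` becomes `w / n - R w = y`. Since `-R` is
  -- accretive, `T` is coercive with constant `1/n`, so its range is closed and has trivial
  -- orthogonal complement, as in Lax–Milgram.
  let T : H →L[ℂ] H := ((n⁻¹ : ℝ) : ℂ) • ContinuousLinearMap.id ℂ H - R'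
  have hT : ∀ w, n⁻¹ * ‖w‖ ^ 2 ≤ (inner ℂ (T w) w).re := by
    intro w
    have e : T w = ((n⁻¹ : ℝ) : ℂ) • w - R w := rfl
    have e2 : (inner ℂ w w).re = ‖w‖ ^ 2 := inner_self_eq_norm_sq (𝕜 := ℂ) w
    rw [e, inner_sub_left, inner_smul_left, Complex.conj_ofReal, Complex.sub_re,
      Complex.re_ofReal_mul, e2]
    linarith [hd w]
  have hTb : ∀ w, ‖w‖ ≤ n * ‖T w‖ := by
    intro w
    rcases (norm_nonneg w).eq_or_lt with h | h
    · rw [← h]; positivity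
    · have h1 : n⁻¹ * ‖w‖ ^ 2 ≤ ‖T w‖ * ‖w‖ :=
        (hT w).trans ((Complex.re_le_norm _).trans (norm_inner_le_norm _ _))
      have h2 : n⁻¹ * ‖w‖ ≤ ‖T w‖ := by
        refine le_of_mul_le_mul_right ?_ h
        calc n⁻¹ * ‖w‖ * ‖w‖ = n⁻¹ * ‖w‖ ^ 2 := by ring
          _ ≤ _ := h1
      rwa [inv_mul_le_iff₀ hn] at h2
  have hanti : AntilipschitzWith n.toNNReal T :=
    ContinuousLinearMap.antilipschitz_of_bound T fun w => by
      rw [Real.coe_toNNReal _ hn.le]; exact hTb w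
  have hcl : IsClosed (T.range : Set H) := hanti.isClosed_range T.uniformContinuous
  have htop : T.range = ⊤ := by
    have := hcl.completeSpace_coe
    rw [← T.range.orthogonal_orthogonal, Submodule.eq_top_iff']
    intro v w hw
    have h1 := hT w
    have h0 : inner ℂ (T w) w = 0 := hw _ ⟨w, rfl⟩
    rw [h0, Complex.zero_re] at h1
    have h2 : ‖w‖ ^ 2 ≤ 0 := nonpos_of_mul_nonpos_right h1 (inv_pos.2 hn)
    have h3 : w = 0 := by
      rw [← norm_eq_zero, ← sq_eq_zero_iff]
      exact le_antisymm h2 (by positivity)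
    rw [h3, inner_zero_left]
  obtain ⟨w, hw⟩ : y ∈ T.range := htop ▸ Submodule.mem_top
  refine ⟨-R w, ?_⟩
  have hw' : ((n⁻¹ : ℝ) : ℂ) • w - R w = y := hw
  have hn' : (n : ℂ) ≠ 0 := by exact_mod_cast hn.ne'
  have e : (n : ℂ) • (-R w - y) = -w := by
    rw [← hw', sub_sub_eq_add_sub, neg_add_cancel, zero_sub, smul_neg, smul_smul]
    push_cast
    rw [mul_inv_cancel₀ hn', one_smul]
  rw [e]
  exact A.graph.neg_mem (hR w)

/-- `J n = n (n - A)⁻¹` for `n > 0`. -/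
structure IsResolvent (A : H →ₗ.[ℂ] H) (J : ℝ → H →L[ℂ] H) : Prop where
  mem_graph : ∀ n : ℝ, 0 < n → ∀ y, (J n y, (n : ℂ) • (J n y - y)) ∈ A.graph
  norm_le : ∀ n : ℝ, 0 < n → ‖J n‖ ≤ 1
  eq_of_mem : ∀ n : ℝ, 0 < n → ∀ x y, (x, (n : ℂ) • (x - y)) ∈ A.graph → J n y = x

/-- Pairing `n (x - y) = A x` with `x` gives `‖x‖² ≤ Re ⟨x, y⟩`, hence `‖x‖ ≤ ‖y‖`. This single
estimate yields uniqueness, therefore linearity, and the contraction bound. -/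
lemma Dissipative.exists_isResolvent {A : H →ₗ.[ℂ] H} (hA : Dissipative A) (hs : Surj A) :
    ∃ J, IsResolvent A J := by
  have main : ∀ n : ℝ, ∃ J : H →L[ℂ] H, 0 < n → (∀ y, (J y, (n : ℂ) • (J y - y)) ∈ A.graph) ∧
      ‖J‖ ≤ 1 ∧ ∀ x y, (x, (n : ℂ) • (x - y)) ∈ A.graph → J y = x := by
    intro n
    by_cases hn : 0 < n
    swap
    · exact ⟨0, fun h => absurd h hn⟩
    choose j hj using hA.exists_resolvent_apply hs hn
    have bound : ∀ x y, (x, (n : ℂ) • (x - y)) ∈ A.graph → ‖x‖ ≤ ‖y‖ := by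
      intro x y h
      have h1 := hA _ _ h
      have e2 : (inner ℂ x x).re = ‖x‖ ^ 2 := inner_self_eq_norm_sq (𝕜 := ℂ) x
      rw [inner_smul_right, Complex.re_ofReal_mul, inner_sub_right, Complex.sub_re, e2] at h1
      have h2 : ‖x‖ ^ 2 - (inner ℂ x y).re ≤ 0 := nonpos_of_mul_nonpos_right h1 hn
      have h3 : (inner ℂ x y).re ≤ ‖x‖ * ‖y‖ :=
        (Complex.re_le_norm _).trans (norm_inner_le_norm _ _)
      by_contra hc
      have : ‖x‖ * ‖y‖ < ‖x‖ * ‖x‖ :=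
        mul_lt_mul_of_pos_left (not_le.1 hc) ((norm_nonneg y).trans_lt (not_le.1 hc))
      nlinarith
    have uniq : ∀ x y, (x, (n : ℂ) • (x - y)) ∈ A.graph → j y = x := by
      intro x y h
      have h1 := A.graph.sub_mem (hj y) h
      have h2 : (j y - x, (n : ℂ) • (j y - x - 0)) ∈ A.graph := by
        rwa [Prod.mk_sub_mk, ← smul_sub, sub_sub_sub_comm, sub_self] at h1
      have := bound _ _ h2
      rw [norm_zero] at this
      exact sub_eq_zero.1 (norm_le_zero_iff.1 this)
    refine ⟨LinearMap.mkContinuous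
      { toFun := j
        map_add' := fun x y => uniq _ _ ?_
        map_smul' := fun c x => uniq _ _ ?_ } 1 (fun y => ?_), fun _ => ⟨hj, ?_, uniq⟩⟩
    · have h := A.graph.add_mem (hj x) (hj y)
      rwa [Prod.mk_add_mk, ← smul_add, sub_add_sub_comm] at h
    · have h := A.graph.smul_mem c (hj x)
      rwa [Prod.smul_mk, smul_comm c, smul_sub c] at h
    · rw [one_mul]
      exact bound _ _ (hj y)
    · exact LinearMap.mkContinuous_norm_le _ zero_le_one _
  choose J hJ using main
  exact ⟨J, fun n hn => (hJ n hn).1, fun n hn => (hJ n hn).2.1, fun n hn => (hJ n hn).2.2⟩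

end Dissipative

lemma norm_sub_three {E : Type*} [SeminormedAddCommGroup E] (a b c d : E) : ‖a - d‖ ≤ ‖a - b‖ + ‖b - c‖ + ‖c - d‖ := by
  have : a - d = (a - b) + (b - c) + (c - d) := by abel
  rw [this]
  exact norm_add₃_le

/-! ### Yosida approximation and construction of the semigroup. -/

section Yosida

variable {H : Type*} [NormedAddCommGroup H] [InnerProductSpace ℂ H]

/-- The norm does not grow along a dissipative evolution. -/
lemma norm_le_of_re_inner_deriv_nonpos {f f' : ℝ → H} {T : ℝ} (hc : ContinuousOn f (Icc 0 T))
    (hf : ∀ t ∈ Ioo 0 T, HasDerivAt f (f' t) t) (h : ∀ t ∈ Ioo 0 T, (inner ℂ (f t) (f' t)).re ≤ 0)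
    {t : ℝ} (ht : t ∈ Icc 0 T) : ‖f t‖ ≤ ‖f 0‖ := by
  let _ : InnerProductSpace ℝ H := InnerProductSpace.rclikeToReal ℂ H
  have hd : ∀ t ∈ Ioo 0 T, HasDerivAt (fun t => ‖f t‖ ^ 2) (2 * inner ℝ (f t) (f' t)) t :=
    fun t ht => (hf t ht).norm_sq
  have hanti : AntitoneOn (fun t => ‖f t‖ ^ 2) (Icc 0 T) := by
    refine antitoneOn_of_deriv_nonpos (convex_Icc 0 T) (hc.norm.pow 2) ?_ ?_
    · rw [interior_Icc]
      exact fun t ht => (hd t ht).differentiableAt.differentiableWithinAt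
    · rw [interior_Icc]
      intro t ht
      rw [(hd t ht).deriv]
      have e : inner ℝ (f t) (f' t) = (inner ℂ (f t) (f' t)).re := rfl
      rw [e]
      linarith [h t ht]
  exact (sq_le_sq₀ (norm_nonneg _) (norm_nonneg _)).1
    (hanti (left_mem_Icc.2 (ht.1.trans ht.2)) ht ht.1)

/-- The Yosida approximations of `A`. -/
def yosida (J : ℝ → H →L[ℂ] H) (n : ℝ) : H →L[ℂ] H := (n : ℂ) • (J n - 1)

lemma yosida_apply (J : ℝ → H →L[ℂ] H) (n : ℝ) (x : H) :
    yosida J n x = (n : ℂ) • (J n x - x) := rfl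

variable {A : H →ₗ.[ℂ] H} {J : ℝ → H →L[ℂ] H}

lemma IsResolvent.norm_apply_le (hJ : IsResolvent A J) {n : ℝ} (hn : 0 < n) (x : H) :
    ‖J n x‖ ≤ ‖x‖ :=
  ((J n).le_of_opNorm_le (hJ.norm_le n hn) x).trans_eq (one_mul _)

lemma exists_approx (hd : Dense (A.domain : Set H)) (x : H) {ε : ℝ} (hε : 0 < ε) :
    ∃ z w, (z, w) ∈ A.graph ∧ ‖x - z‖ < ε := by
  obtain ⟨z, hz, hxz⟩ := hd.exists_dist_lt x hε
  exact ⟨z, A ⟨z, hz⟩, A.mem_graph ⟨z, hz⟩, by rwa [← dist_eq_norm]⟩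

lemma IsResolvent.re_inner_yosida_nonpos (hJ : IsResolvent A J) {n : ℝ} (hn : 0 < n) (x : H) :
    (inner ℂ x (yosida J n x)).re ≤ 0 := by
  have e2 : (inner ℂ x x).re = ‖x‖ ^ 2 := inner_self_eq_norm_sq (𝕜 := ℂ) x
  rw [yosida_apply, inner_smul_right, Complex.re_ofReal_mul, inner_sub_right, Complex.sub_re, e2]
  have h3 : (inner ℂ x (J n x)).re ≤ ‖x‖ * ‖J n x‖ :=
    (Complex.re_le_norm _).trans (norm_inner_le_norm _ _)
  have h4 : ‖x‖ * ‖J n x‖ ≤ ‖x‖ * ‖x‖ :=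
    mul_le_mul_of_nonneg_left (hJ.norm_apply_le hn x) (norm_nonneg _)
  exact mul_nonpos_of_nonneg_of_nonpos hn.le (by nlinarith)

/-- The resolvent equation for `x` reads `J n (x - y / n) = x`; expanding by linearity gives the
claim. So on `D(A)` the Yosida approximation is `J n ∘ A`, which is bounded uniformly in `n`. -/
lemma IsResolvent.yosida_eq (hJ : IsResolvent A J) {n : ℝ} (hn : 0 < n) {x y : H}
    (h : (x, y) ∈ A.graph) : yosida J n x = J n y := by
  have hn' : (n : ℂ) ≠ 0 := by exact_mod_cast hn.ne'
  have h1 : J n (x - (n : ℂ)⁻¹ • y) = x := hJ.eq_of_mem n hn _ _ (by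
    rwa [sub_sub_cancel, smul_smul, mul_inv_cancel₀ hn', one_smul])
  rw [map_sub, map_smul, sub_eq_iff_eq_add] at h1
  rw [yosida_apply, h1, add_sub_cancel_left, smul_smul, mul_inv_cancel₀ hn', one_smul]

lemma IsResolvent.commute (hJ : IsResolvent A J) {n k : ℝ} (hn : 0 < n) (hk : 0 < k) :
    Commute (J n) (J k) := by
  ext x
  change J n (J k x) = J k (J n x)
  -- It suffices that `J k (J n x)` solves the `n`-resolvent equation with datum `J k x`. By
  -- `yosida_eq`, `A` sends it to `J k` applied to `n (J n x - x)`.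
  refine hJ.eq_of_mem n hn _ _ ?_
  have h1 := hJ.yosida_eq hk (hJ.mem_graph n hn x)
  rw [map_smul, map_sub] at h1
  rw [← h1]
  exact hJ.mem_graph k hk _

lemma IsResolvent.commute_yosida (hJ : IsResolvent A J) {n k : ℝ} (hn : 0 < n) (hk : 0 < k) :
    Commute (yosida J n) (yosida J k) := by
  have h1 : Commute (J n - 1) (J k - 1) :=
    (((hJ.commute hn hk).sub_left (Commute.one_left _)).sub_right (Commute.one_right _))
  exact (h1.smul_left _).smul_right _

/-- On `D(A)` one has `‖J n z - z‖ ≤ ‖A z‖ / n`; density and the uniform bound `‖J n‖ ≤ 1` extend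
the convergence to all vectors. -/
lemma IsResolvent.tendsto (hJ : IsResolvent A J) (hd : Dense (A.domain : Set H)) (x : H) :
    Tendsto (fun n : ℝ => J n x) atTop (𝓝 x) := by
  rw [Metric.tendsto_atTop]
  intro ε hε
  obtain ⟨z, w, hzw, hxz⟩ := exists_approx hd x (ε := ε / 3) (by positivity)
  refine ⟨max 1 (3 * (‖w‖ + 1) / ε), fun n hn => ?_⟩
  have hn0 : 0 < n := one_pos.trans_le ((le_max_left _ _).trans hn)
  have hn1 : 3 * (‖w‖ + 1) / ε ≤ n := (le_max_right _ _).trans hn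
  have h1 : ‖J n x - J n z‖ < ε / 3 := by
    rw [← map_sub]
    exact (hJ.norm_apply_le hn0 _).trans_lt hxz
  have h2 : ‖J n z - z‖ < ε / 3 := by
    have h3 : n * ‖J n z - z‖ ≤ ‖w‖ := by
      have h4 := congrArg norm (hJ.yosida_eq hn0 hzw)
      rw [yosida_apply, norm_smul, Complex.norm_real, Real.norm_of_nonneg hn0.le] at h4
      rw [h4]
      exact hJ.norm_apply_le hn0 _
    rw [div_le_iff₀ hε] at hn1
    by_contra hc
    rw [not_lt] at hc
    have := mul_le_mul_of_nonneg_left hc hn0.le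
    linarith
  have h3 : ‖z - x‖ < ε / 3 := by rwa [norm_sub_rev]
  rw [dist_eq_norm]
  linarith [norm_sub_three (J n x) (J n z) z x]

lemma IsResolvent.tendsto_yosida (hJ : IsResolvent A J) (hd : Dense (A.domain : Set H)) {x y : H}
    (h : (x, y) ∈ A.graph) : Tendsto (fun n : ℝ => yosida J n x) atTop (𝓝 y) := by
  refine (hJ.tendsto hd y).congr' ?_
  filter_upwards [eventually_gt_atTop 0] with n hn
  exact (hJ.yosida_eq hn h).symm

variable [CompleteSpace H]

lemma hasDerivAt_exp_apply (B : H →L[ℂ] H) (x : H) (t : ℝ) :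
    HasDerivAt (fun t : ℝ => NormedSpace.exp (t • B) x) (NormedSpace.exp (t • B) (B x)) t := by
  have h := hasDerivAt_exp_smul_const (𝕂 := ℝ) B t
  exact (((ContinuousLinearMap.apply ℂ H x).restrictScalars ℝ).hasFDerivAt.comp_hasDerivAt t h)

lemma exp_commute (B : H →L[ℂ] H) (x : H) (t : ℝ) :
    NormedSpace.exp (t • B) (B x) = B (NormedSpace.exp (t • B) x) := by
  have : Commute (NormedSpace.exp (t • B)) B := ((Commute.refl B).smul_left t).exp_left
  exact DFunLike.congr_fun this x

lemma norm_exp_apply_le {B : H →L[ℂ] H} (hB : ∀ x, (inner ℂ x (B x)).re ≤ 0) {t : ℝ}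
    (ht : 0 ≤ t) (x : H) : ‖NormedSpace.exp (t • B) x‖ ≤ ‖x‖ := by
  have hd := hasDerivAt_exp_apply B x
  have := norm_le_of_re_inner_deriv_nonpos (T := t)
    (fun s _ => (hd s).continuousAt.continuousWithinAt) (fun s _ => hd s)
    (fun s _ => by rw [exp_commute]; exact hB _) (right_mem_Icc.2 ht)
  simpa using this

/-- The path `s ↦ exp(sB) exp((t - s)C) x` joins the two exponentials. As `B` and `C` commute, its
derivative is a product of contractions applied to `B x - C x`. -/
lemma norm_exp_sub_exp_le {B C : H →L[ℂ] H} (hB : ∀ x, (inner ℂ x (B x)).re ≤ 0)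
    (hC : ∀ x, (inner ℂ x (C x)).re ≤ 0) (h : Commute B C) {t : ℝ} (ht : 0 ≤ t) (x : H) :
    ‖NormedSpace.exp (t • B) x - NormedSpace.exp (t • C) x‖ ≤ ‖B x - C x‖ * t := by
  have hd : ∀ s : ℝ, HasDerivAt
      (fun s : ℝ => (NormedSpace.exp (s • B) * NormedSpace.exp ((t - s) • C)) x)
      (NormedSpace.exp (s • B) (NormedSpace.exp ((t - s) • C) (B x - C x))) s := by
    intro s
    have h1 := hasDerivAt_exp_smul_const (𝕂 := ℝ) B s
    have h2 := (hasDerivAt_exp_smul_const (𝕂 := ℝ) C (t - s)).scomp s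
      ((hasDerivAt_id s).const_sub t)
    have h3 := h1.mul h2
    have h4 := ((ContinuousLinearMap.apply ℂ H x).restrictScalars ℝ).hasFDerivAt.comp_hasDerivAt s h3
    have hBC : Commute B (NormedSpace.exp ((t - s) • C)) := (h.smul_right _).exp_right
    refine h4.congr_deriv ?_
    change NormedSpace.exp (s • B) (B (NormedSpace.exp ((t - s) • C) x)) +
      NormedSpace.exp (s • B) ((-1 : ℝ) • NormedSpace.exp ((t - s) • C) (C x)) = _
    have e : B (NormedSpace.exp ((t - s) • C) x) = NormedSpace.exp ((t - s) • C) (B x) :=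
      DFunLike.congr_fun hBC x
    rw [e, ← map_add, map_sub, neg_one_smul, ← sub_eq_add_neg]
  have := norm_image_sub_le_of_norm_deriv_le_segment' (a := 0) (b := t) (C := ‖B x - C x‖)
    (fun s _ => (hd s).hasDerivWithinAt) (fun s hs =>
      (norm_exp_apply_le hB hs.1 _).trans (norm_exp_apply_le hC (sub_nonneg.2 hs.2.le) _))
    t (right_mem_Icc.2 ht)
  simpa using this

/-- The contraction semigroup generated by the Yosida approximation, extended by the identity to
negative times. -/
def yosidaExp (J : ℝ → H →L[ℂ] H) (n t : ℝ) : H →L[ℂ] H :=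
  NormedSpace.exp (max t 0 • yosida J n)

lemma IsResolvent.norm_yosidaExp_apply_le (hJ : IsResolvent A J) {n : ℝ} (hn : 0 < n) (t : ℝ)
    (x : H) : ‖yosidaExp J n t x‖ ≤ ‖x‖ :=
  norm_exp_apply_le (hJ.re_inner_yosida_nonpos hn) (le_max_right _ _) x

/-- On `D(A)` the exponentials differ by at most `t` times the difference of the Yosida
approximations, which converge there. Contractivity transfers the Cauchy property to the whole
space. -/
lemma IsResolvent.exists_limit (hJ : IsResolvent A J) (hd : Dense (A.domain : Set H)) (t : ℝ)
    (x : H) : ∃ y, Tendsto (fun n : ℝ => yosidaExp J n t x) atTop (𝓝 y) := by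
  rw [← cauchy_map_iff_exists_tendsto, Metric.cauchy_iff]
  refine ⟨inferInstance, fun ε hε => ?_⟩
  obtain ⟨z, w, hzw, hxz⟩ := exists_approx hd x (ε := ε / 4) (by positivity)
  -- Two such errors, multiplied by the elapsed time `max t 0`, stay below `ε / 4`; the `+ 1` avoids
  -- division by zero.
  have hη : 0 < ε / (8 * (max t 0 + 1)) := by positivity
  have hev := (Metric.tendsto_atTop.1 (hJ.tendsto_yosida hd hzw)) _ hη
  obtain ⟨N, hN⟩ := hev
  refine ⟨(fun n : ℝ => yosidaExp J n t x) '' Ici (max N 1), image_mem_map (Ici_mem_atTop _), ?_⟩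
  rintro _ ⟨n, hn, rfl⟩ _ ⟨k, hk, rfl⟩
  have hn0 : 0 < n := one_pos.trans_le ((le_max_right _ _).trans hn)
  have hk0 : 0 < k := one_pos.trans_le ((le_max_right _ _).trans hk)
  have h1 : ∀ n, 0 < n → ‖yosidaExp J n t x - yosidaExp J n t z‖ < ε / 4 := fun n hn => by
    rw [← map_sub]
    exact (hJ.norm_yosidaExp_apply_le hn _ _).trans_lt hxz
  have h2 := norm_exp_sub_exp_le (hJ.re_inner_yosida_nonpos hn0) (hJ.re_inner_yosida_nonpos hk0)
    (hJ.commute_yosida hn0 hk0) (le_max_right t 0) z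
  have h3 : ‖yosida J n z - yosida J k z‖ ≤ ε / (4 * (max t 0 + 1)) := by
    have a := hN n ((le_max_left _ _).trans hn)
    have b := hN k ((le_max_left _ _).trans hk)
    rw [← dist_eq_norm]
    refine (dist_triangle_right _ _ w).trans ((add_le_add a.le b.le).trans_eq ?_)
    field_simp
    norm_num
  have h4 : ‖yosidaExp J n t z - yosidaExp J k t z‖ ≤ ε / 4 := by
    refine h2.trans ((mul_le_mul_of_nonneg_right h3 (le_max_right t 0)).trans ?_)
    have ht : 0 ≤ max t 0 := le_max_right t 0
    rw [div_mul_eq_mul_div, div_le_div_iff₀ (by positivity) (by positivity)]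
    nlinarith
  have h5 := h1 n hn0
  have h6 := h1 k hk0
  rw [norm_sub_rev] at h6
  rw [dist_eq_norm]
  linarith [norm_sub_three (yosidaExp J n t x) (yosidaExp J n t z) (yosidaExp J k t z)
    (yosidaExp J k t x)]

/-- The limit semigroup. -/
lemma IsResolvent.exists_semigroup (hJ : IsResolvent A J) (hd : Dense (A.domain : Set H)) :
    ∃ S : ℝ → H →L[ℂ] H,
      ∀ t x, Tendsto (fun n : ℝ => yosidaExp J n t x) atTop (𝓝 (S t x)) := by
  choose s hs using hJ.exists_limit hd
  refine ⟨fun t => LinearMap.mkContinuous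
    { toFun := s t
      map_add' := fun x y => ?_
      map_smul' := fun c x => ?_ } 1 fun x => ?_, hs⟩
  · refine tendsto_nhds_unique (hs t (x + y)) ?_
    simpa only [map_add] using (hs t x).add (hs t y)
  · refine tendsto_nhds_unique (hs t (c • x)) ?_
    simpa only [map_smul, RingHom.id_apply] using (hs t x).const_smul c
  · rw [one_mul]
    refine le_of_tendsto (hs t x).norm ?_
    filter_upwards [eventually_gt_atTop 0] with n hn
    exact hJ.norm_yosidaExp_apply_le hn t x

variable {S : ℝ → H →L[ℂ] H}

lemma IsResolvent.norm_semigroup_apply_le (hJ : IsResolvent A J)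
    (hS : ∀ t x, Tendsto (fun n : ℝ => yosidaExp J n t x) atTop (𝓝 (S t x))) (t : ℝ) (x : H) :
    ‖S t x‖ ≤ ‖x‖ := by
  refine le_of_tendsto (hS t x).norm ?_
  filter_upwards [eventually_gt_atTop 0] with n hn
  exact hJ.norm_yosidaExp_apply_le hn t x

lemma semigroup_zero (hS : ∀ t x, Tendsto (fun n : ℝ => yosidaExp J n t x) atTop (𝓝 (S t x))) :
    S 0 = ContinuousLinearMap.id ℂ H := by
  ext x
  refine tendsto_nhds_unique (hS 0 x) ?_
  simp [yosidaExp]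

lemma yosidaExp_add (n : ℝ) {s t : ℝ} (hs : 0 ≤ s) (ht : 0 ≤ t) (x : H) :
    yosidaExp J n (s + t) x = yosidaExp J n s (yosidaExp J n t x) := by
  simp only [yosidaExp, max_eq_left hs, max_eq_left ht, max_eq_left (add_nonneg hs ht), add_smul]
  let _ : NormedAlgebra ℚ (H →L[ℂ] H) := NormedAlgebra.restrictScalars ℚ ℂ _
  rw [NormedSpace.exp_add_of_commute (((Commute.refl _).smul_left _).smul_right _)]
  rfl

lemma IsResolvent.semigroup_add (hJ : IsResolvent A J)
    (hS : ∀ t x, Tendsto (fun n : ℝ => yosidaExp J n t x) atTop (𝓝 (S t x))) {s t : ℝ}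
    (hs : 0 ≤ s) (ht : 0 ≤ t) : S (s + t) = (S s).comp (S t) := by
  ext x
  refine tendsto_nhds_unique (hS (s + t) x) ?_
  have h1 := hS s (S t x)
  -- Both factors vary with `n`; the uniform contraction bound on the outer one makes the error of
  -- the inner one harmless.
  have h2 : Tendsto (fun n : ℝ => yosidaExp J n s (yosidaExp J n t x - S t x)) atTop (𝓝 0) := by
    have h3 := (tendsto_iff_norm_sub_tendsto_zero.1 (hS t x))
    refine squeeze_zero_norm' ?_ h3
    filter_upwards [eventually_gt_atTop 0] with n hn
    exact hJ.norm_yosidaExp_apply_le hn s _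
  have h4 := h2.add h1
  rw [zero_add] at h4
  refine h4.congr fun n => ?_
  rw [← map_add, sub_add_cancel, yosidaExp_add n hs ht]

lemma continuous_yosidaExp_apply (n : ℝ) (x : H) : Continuous fun t => yosidaExp J n t x := by
  have h : Continuous fun t : ℝ => NormedSpace.exp (t • yosida J n) x :=
    continuous_iff_continuousAt.2 fun t => (hasDerivAt_exp_apply _ x t).continuousAt
  exact h.comp (continuous_id.max continuous_const)

/-- `S t x = x + ∫₀ᵗ S s (A x) ds` for `x ∈ D(A)`. -/
lemma IsResolvent.semigroup_eq_integral (hJ : IsResolvent A J) (hd : Dense (A.domain : Set H))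
    (hS : ∀ t x, Tendsto (fun n : ℝ => yosidaExp J n t x) atTop (𝓝 (S t x))) {x y : H}
    (h : (x, y) ∈ A.graph) {t : ℝ} (ht : 0 ≤ t) : S t x = x + ∫ s in (0 : ℝ)..t, S s y := by
  have h1 : ∀ n, yosidaExp J n t x = x + ∫ s in (0 : ℝ)..t, yosidaExp J n s (yosida J n x) := by
    intro n
    have h2 : ∫ s in (0 : ℝ)..t, yosidaExp J n s (yosida J n x) =
        ∫ s in (0 : ℝ)..t, NormedSpace.exp (s • yosida J n) (yosida J n x) := by
      refine intervalIntegral.integral_congr fun s hs => ?_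
      rw [uIcc_of_le ht] at hs
      simp only [yosidaExp, max_eq_left hs.1]
    have h3 : Continuous fun t : ℝ => NormedSpace.exp (t • yosida J n) (yosida J n x) :=
      continuous_iff_continuousAt.2 fun t => (hasDerivAt_exp_apply _ _ t).continuousAt
    rw [h2, intervalIntegral.integral_eq_sub_of_hasDerivAt
      (fun s _ => hasDerivAt_exp_apply (yosida J n) x s) (h3.intervalIntegrable _ _)]
    simp [yosidaExp, max_eq_left ht]
  have h2 : Tendsto (fun n => ∫ s in (0 : ℝ)..t, yosidaExp J n s (yosida J n x)) atTop
      (𝓝 (∫ s in (0 : ℝ)..t, S s y)) := by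
    refine intervalIntegral.tendsto_integral_filter_of_dominated_convergence (fun _ => ‖y‖) ?_ ?_
      intervalIntegrable_const ?_
    · exact Eventually.of_forall fun n =>
        (continuous_yosidaExp_apply n _).aestronglyMeasurable
    · filter_upwards [eventually_gt_atTop 0] with n hn
      refine ae_of_all _ fun s _ => (hJ.norm_yosidaExp_apply_le hn _ _).trans ?_
      rw [hJ.yosida_eq hn h]
      exact hJ.norm_apply_le hn y
    · refine ae_of_all _ fun s _ => ?_
      have h3 : Tendsto (fun n : ℝ => yosidaExp J n s (yosida J n x - y)) atTop (𝓝 0) := by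
        refine squeeze_zero_norm' ?_ (tendsto_iff_norm_sub_tendsto_zero.1 (hJ.tendsto_yosida hd h))
        filter_upwards [eventually_gt_atTop 0] with n hn
        exact hJ.norm_yosidaExp_apply_le hn s _
      have h4 := h3.add (hS s y)
      rw [zero_add] at h4
      refine h4.congr fun n => ?_
      rw [← map_add, sub_add_cancel]
  exact tendsto_nhds_unique (hS t x) ((h2.const_add x).congr fun n => (h1 n).symm)

lemma IsResolvent.norm_semigroup_sub_le (hJ : IsResolvent A J) (hd : Dense (A.domain : Set H))
    (hS : ∀ t x, Tendsto (fun n : ℝ => yosidaExp J n t x) atTop (𝓝 (S t x))) {x y : H}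
    (h : (x, y) ∈ A.graph) {s t : ℝ} (hs : 0 ≤ s) (hst : s ≤ t) :
    ‖S t x - S s x‖ ≤ ‖y‖ * (t - s) := by
  have e : S t x - S s x = S s (S (t - s) x - x) := by
    rw [map_sub]
    congr 1
    have := DFunLike.congr_fun (hJ.semigroup_add hS hs (sub_nonneg.2 hst)) x
    rwa [add_sub_cancel] at this
  rw [e, hJ.semigroup_eq_integral hd hS h (sub_nonneg.2 hst), add_sub_cancel_left]
  refine (hJ.norm_semigroup_apply_le hS _ _).trans ?_
  refine (intervalIntegral.norm_integral_le_of_norm_le_const (C := ‖y‖)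
    fun r _ => hJ.norm_semigroup_apply_le hS r y).trans_eq ?_
  rw [sub_zero, abs_of_nonneg (sub_nonneg.2 hst)]

/-- The family is frozen at its value at `0` for negative times, so orbits are continuous on all of
`ℝ` and no one-sided statements are needed later. -/
lemma semigroup_max (hS : ∀ t x, Tendsto (fun n : ℝ => yosidaExp J n t x) atTop (𝓝 (S t x)))
    (t : ℝ) (x : H) : S (max t 0) x = S t x :=
  tendsto_nhds_unique (hS _ x) (by simpa [yosidaExp] using hS t x)

/-- Orbits starting in `D(A)` are Lipschitz for `t ≥ 0`, and every orbit is a uniform limit of these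
by density and contractivity. -/
lemma IsResolvent.continuous_semigroup (hJ : IsResolvent A J) (hd : Dense (A.domain : Set H))
    (hS : ∀ t x, Tendsto (fun n : ℝ => yosidaExp J n t x) atTop (𝓝 (S t x))) (x : H) :
    Continuous fun t => S t x := by
  have hD : ∀ z w, (z, w) ∈ A.graph → Continuous fun t => S t z := by
    intro z w hzw
    have hL : LipschitzWith ‖w‖₊ fun t : Ici (0 : ℝ) => S t z := by
      refine LipschitzWith.of_dist_le_mul fun s t => ?_
      wlog hst : (s : ℝ) ≤ t generalizing s t
      · rw [dist_comm, dist_comm s]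
        exact this t s (le_of_not_ge hst)
      rw [dist_comm, dist_eq_norm, Subtype.dist_eq, dist_comm, Real.dist_eq,
        abs_of_nonneg (sub_nonneg.2 hst)]
      exact hJ.norm_semigroup_sub_le hd hS hzw s.2 hst
    have h1 : Continuous fun t : ℝ => (⟨max t 0, le_max_right t 0⟩ : Ici (0 : ℝ)) :=
      (continuous_id.max continuous_const).subtype_mk _
    exact (hL.continuous.comp h1).congr fun t => semigroup_max hS t z
  refine continuous_of_uniform_approx_of_continuous fun V hV => ?_
  obtain ⟨ε, hε, hεV⟩ := Metric.mem_uniformity_dist.1 hV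
  obtain ⟨z, w, hzw, hxz⟩ := exists_approx hd x hε
  refine ⟨fun t => S t z, hD z w hzw, fun t => hεV ?_⟩
  rw [dist_eq_norm, ← map_sub]
  exact (hJ.norm_semigroup_apply_le hS t _).trans_lt hxz

end Yosida

/-! ### Generator, mild solutions and strict solutions. -/

section Cauchy

variable {H : Type*} [NormedAddCommGroup H] [InnerProductSpace ℂ H]
  {A : H →ₗ.[ℂ] H} {S : ℝ → H →L[ℂ] H}

lemma norm_apply_le_of_contraction (hS : IsContractionSemigroup S) {t : ℝ} (ht : 0 ≤ t) (x : H) :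
    ‖S t x‖ ≤ ‖x‖ :=
  ((S t).le_of_opNorm_le (hS.contraction t ht) x).trans_eq (one_mul _)

lemma orbit_mem_graph (hS : IsContractionSemigroup S) (hG : IsGenerator A S) {x y : H}
    (h : (x, y) ∈ A.graph) {t : ℝ} (ht : 0 ≤ t) : (S t x, S t y) ∈ A.graph := by
  rw [hG] at h ⊢
  refine (((S t).continuous.tendsto y).comp h).congr' ?_
  filter_upwards [self_mem_nhdsWithin] with r hr
  have e : S t (S r x) = S r (S t x) := by
    rw [← ContinuousLinearMap.comp_apply, ← hS.add t r ht (le_of_lt hr), add_comm,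
      hS.add r t (le_of_lt hr) ht, ContinuousLinearMap.comp_apply]
  rw [Function.comp_apply, ← Complex.coe_smul, ← Complex.coe_smul, map_smul, map_sub, e]

variable [CompleteSpace H]

lemma hasDerivAt_integral_orbit (hc : ∀ x, Continuous fun t => S t x) (x : H) (t : ℝ) :
    HasDerivAt (fun t => ∫ s in (0 : ℝ)..t, S s x) (S t x) t :=
  intervalIntegral.integral_hasDerivAt_right ((hc x).intervalIntegrable _ _)
    ((hc x).stronglyMeasurableAtFilter _ _) (hc x).continuousAt

/-- A dissipative operator that is onto is the generator of every contraction semigroup that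
satisfies the integrated equation on `D(A)`. -/
lemma isGenerator_of_integral (hA : Dissipative A) (hs : Surj A) (hS : IsContractionSemigroup S)
    (hc : ∀ x, Continuous fun t => S t x)
    (hi : ∀ x y, (x, y) ∈ A.graph → ∀ t, 0 ≤ t → S t x = x + ∫ s in (0 : ℝ)..t, S s y) :
    IsGenerator A S := by
  have fwd : ∀ x y, (x, y) ∈ A.graph →
      Tendsto (fun t : ℝ => t⁻¹ • (S t x - x)) (𝓝[>] 0) (𝓝 y) := by
    intro x y h
    have h1 := (hasDerivAt_integral_orbit hc y 0).tendsto_slope_zero_right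
    rw [hS.zero] at h1
    refine h1.congr' ?_
    filter_upwards [self_mem_nhdsWithin] with t ht
    rw [hi x y h t (le_of_lt ht), zero_add, intervalIntegral.integral_same, sub_zero,
      add_sub_cancel_left]
  refine fun x y => ⟨fwd x y, fun h => ?_⟩
  -- Here `z - A z = x - y`, so the difference quotients of `S` at `x - z` tend to `x - z` itself.
  -- Contractivity makes their pairing with `x - z` non-positive in real part, so `x = z ∈ D(A)`.
  obtain ⟨z, hz⟩ := hA.exists_resolvent_apply hs one_pos (x - y)
  rw [Complex.ofReal_one, one_smul] at hz
  have h1 := h.sub (fwd _ _ hz)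
  have e : y - (z - (x - y)) = x - z := by abel
  have e' : ∀ t : ℝ, t⁻¹ • (S t x - x) - t⁻¹ • (S t z - z) = t⁻¹ • (S t (x - z) - (x - z)) := by
    intro t
    rw [← smul_sub, map_sub, sub_sub_sub_comm]
  simp only [e, e'] at h1
  have h2 : (inner ℂ (x - z) (x - z)).re ≤ 0 := by
    have h3 : Tendsto
        (fun t : ℝ => (inner ℂ (x - z) (t⁻¹ • (S t (x - z) - (x - z)))).re) (𝓝[>] 0)
        (𝓝 (inner ℂ (x - z) (x - z)).re) :=
      (Complex.continuous_re.tendsto _).comp (tendsto_const_nhds.inner h1)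
    refine le_of_tendsto h3 ?_
    filter_upwards [self_mem_nhdsWithin] with t ht
    have ht' : 0 < t := ht
    have e2 : (inner ℂ (x - z) (x - z)).re = ‖x - z‖ ^ 2 := inner_self_eq_norm_sq (𝕜 := ℂ) _
    rw [← Complex.coe_smul, inner_smul_right, Complex.re_ofReal_mul, inner_sub_right,
      Complex.sub_re, e2]
    have h3 : (inner ℂ (x - z) (S t (x - z))).re ≤ ‖x - z‖ * ‖S t (x - z)‖ :=
      (Complex.re_le_norm _).trans (norm_inner_le_norm _ _)
    have h4 : ‖x - z‖ * ‖S t (x - z)‖ ≤ ‖x - z‖ * ‖x - z‖ :=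
      mul_le_mul_of_nonneg_left (norm_apply_le_of_contraction hS ht'.le _) (norm_nonneg _)
    exact mul_nonpos_of_nonneg_of_nonpos (inv_pos.2 ht').le (by nlinarith)
  have h3 : x - z = 0 := by
    have e2 : (inner ℂ (x - z) (x - z)).re = ‖x - z‖ ^ 2 := inner_self_eq_norm_sq (𝕜 := ℂ) _
    rw [e2] at h2
    rw [← norm_eq_zero, ← sq_eq_zero_iff]
    exact le_antisymm h2 (by positivity)
  have h4 : z = x := (sub_eq_zero.1 h3).symm
  rwa [h4, sub_sub_cancel] at hz

/-- The Lumer–Phillips theorem on a Hilbert space, for operators that are onto. -/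
theorem Dissipative.exists_contractionSemigroup (hA : Dissipative A) (hs : Surj A) :
    ∃ S : ℝ → H →L[ℂ] H, IsContractionSemigroup S ∧ IsGenerator A S ∧
      (∀ x, Continuous fun t => S t x) ∧
      ∀ x y, (x, y) ∈ A.graph → ∀ t, 0 ≤ t → S t x = x + ∫ s in (0 : ℝ)..t, S s y := by
  obtain ⟨J, hJ⟩ := hA.exists_isResolvent hs
  have hd := hA.dense_domain hs
  obtain ⟨S, hS⟩ := hJ.exists_semigroup hd
  have hc := hJ.continuous_semigroup hd hS
  have hi : ∀ x y, (x, y) ∈ A.graph → ∀ t, 0 ≤ t → S t x = x + ∫ s in (0 : ℝ)..t, S s y :=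
    fun x y h t ht => hJ.semigroup_eq_integral hd hS h ht
  have hS' : IsContractionSemigroup S :=
    { zero := semigroup_zero hS
      add := fun s t hs ht => hJ.semigroup_add hS hs ht
      strong_cont := fun x => by
        have := ((hc x).tendsto 0).mono_left (nhdsWithin_le_nhds (s := Ioi 0))
        rwa [semigroup_zero hS] at this
      contraction := fun t _ => ContinuousLinearMap.opNorm_le_bound _ zero_le_one fun x => by
        rw [one_mul]
        exact hJ.norm_semigroup_apply_le hS t x }
  exact ⟨S, hS', isGenerator_of_integral hA hs hS' hc hi, hc, hi⟩

/-- The semigroup law shifts the integral over `[0, t]` to `[h, h + t]`, so the difference quotient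
is that of the primitive at `t` minus that at `0`. -/
lemma integral_orbit_mem_graph (hS : IsContractionSemigroup S) (hG : IsGenerator A S)
    (hc : ∀ x, Continuous fun t => S t x) (x : H) {t : ℝ} (ht : 0 ≤ t) :
    (∫ s in (0 : ℝ)..t, S s x, S t x - x) ∈ A.graph := by
  rw [hG]
  have h1 := (hasDerivAt_integral_orbit hc x t).tendsto_slope_zero_right
  have h2 := (hasDerivAt_integral_orbit hc x 0).tendsto_slope_zero_right
  have e0 : S 0 x = x := by rw [hS.zero]; rfl
  rw [e0] at h2
  refine (h1.sub h2).congr' ?_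
  filter_upwards [self_mem_nhdsWithin] with h hh
  have e1 : S h (∫ s in (0 : ℝ)..t, S s x) = ∫ s in h..(h + t), S s x := by
    rw [← ContinuousLinearMap.intervalIntegral_comp_comm _ ((hc x).intervalIntegrable _ _)]
    have e2 : ∫ s in (0 : ℝ)..t, S h (S s x) = ∫ s in (0 : ℝ)..t, S (h + s) x := by
      refine intervalIntegral.integral_congr fun s hs' => ?_
      rw [uIcc_of_le ht] at hs'
      simp only [hS.add h s (le_of_lt hh) hs'.1, ContinuousLinearMap.comp_apply]
    rw [e2, intervalIntegral.integral_comp_add_left (fun s => S s x) h, add_zero]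
  rw [e1, ← smul_sub, zero_add, intervalIntegral.integral_same, sub_zero, add_comm t h,
    ← intervalIntegral.integral_interval_sub_left ((hc x).intervalIntegrable 0 (h + t))
      ((hc x).intervalIntegrable 0 h)]
  congr 1
  abel

/-- The only mild solution with vanishing initial value is `0`. -/
lemma Dissipative.mild_unique (hA : Dissipative A) (hs : Surj A) {T : ℝ} {W : ℝ → H}
    (hW : IntervalIntegrable W volume 0 T)
    (h : ∀ t ∈ Icc 0 T, (∫ s in (0 : ℝ)..t, W s, W t) ∈ A.graph) {t : ℝ} (ht : t ∈ Icc 0 T) :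
    W t = 0 := by
  obtain ⟨J, hJ⟩ := hA.exists_isResolvent hs
  have hT : 0 ≤ T := ht.1.trans ht.2
  set V : ℝ → H := fun t => ∫ s in (0 : ℝ)..t, W s with hV
  have hVc : ContinuousOn V (Icc 0 T) := by
    have := intervalIntegral.continuousOn_primitive_interval' hW left_mem_uIcc
    rwa [uIcc_of_le hT] at this
  -- `W` is only integrable, so `V` need not be differentiable. Its regularisation `J 1 ∘ V` is, and
  -- solves `X' = A X` with `X 0 = 0`, because `A (J 1 v) = J 1 v - v`.
  have hJV : ∀ t ∈ Icc 0 T, J 1 (W t) = J 1 (V t) - V t := fun t ht => by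
    rw [← hJ.yosida_eq one_pos (h t ht), yosida_apply, Complex.ofReal_one, one_smul]
  have hX : ∀ t ∈ Icc 0 T, J 1 (V t) = ∫ s in (0 : ℝ)..t, (J 1 (V s) - V s) := by
    intro t ht
    have hWt : IntervalIntegrable W volume 0 t := hW.mono_set (by
      rw [uIcc_of_le ht.1, uIcc_of_le hT]; exact Icc_subset_Icc_right ht.2)
    rw [hV, ← ContinuousLinearMap.intervalIntegral_comp_comm _ hWt]
    refine intervalIntegral.integral_congr fun s hs' => ?_
    rw [uIcc_of_le ht.1] at hs'
    exact hJV s ⟨hs'.1, hs'.2.trans ht.2⟩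
  have hfc : ContinuousOn (fun s => J 1 (V s) - V s) (Icc 0 T) :=
    ((J 1).continuous.comp_continuousOn hVc).sub hVc
  have hd : ∀ t ∈ Ioo 0 T, HasDerivAt (fun t => J 1 (V t)) (J 1 (V t) - V t) t := by
    intro t ht
    have h1 : HasDerivAt (fun t => ∫ s in (0 : ℝ)..t, (J 1 (V s) - V s)) (J 1 (V t) - V t) t := by
      refine intervalIntegral.integral_hasDerivAt_right ?_ ?_ ?_
      · refine (hfc.mono ?_).intervalIntegrable
        rw [uIcc_of_le ht.1.le]; exact Icc_subset_Icc_right ht.2.le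
      · exact (hfc.mono Ioo_subset_Icc_self).stronglyMeasurableAtFilter isOpen_Ioo t ht
      · exact hfc.continuousAt (Icc_mem_nhds ht.1 ht.2)
    refine h1.congr_of_eventuallyEq ?_
    filter_upwards [Icc_mem_nhds ht.1 ht.2] with s hs'
    exact hX s hs'
  have h0 := norm_le_of_re_inner_deriv_nonpos ((J 1).continuous.comp_continuousOn hVc) hd
    (fun t _ => by
      have := hA _ _ (hJ.mem_graph 1 one_pos (V t))
      rwa [Complex.ofReal_one, one_smul] at this) ht
  have hV0 : V 0 = 0 := intervalIntegral.integral_same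
  rw [Function.comp_apply, Function.comp_apply, hV0, map_zero, norm_zero, norm_le_zero_iff] at h0
  have h1 := hJ.mem_graph 1 one_pos (V t)
  rw [h0, zero_sub, Complex.ofReal_one, one_smul] at h1
  have h2 : V t = 0 := neg_eq_zero.1 (A.graph_fst_eq_zero_snd h1 rfl)
  have h3 := h t ht
  rw [show (∫ s in (0 : ℝ)..t, W s) = V t from rfl, h2] at h3
  exact A.graph_fst_eq_zero_snd h3 rfl

/-- Well-posedness of `U' = A U` for a dissipative operator that is onto. -/
theorem Dissipative.wellPosed (hA : Dissipative A) (hs : Surj A) :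
    ∃ S : ℝ → H →L[ℂ] H, IsContractionSemigroup S ∧ IsGenerator A S ∧
      ∀ T : ℝ, 0 < T → ∀ U₀ : H,
        (∃ U : ℝ → H, IsMildSolution A T U₀ U) ∧
        (∀ U : ℝ → H, IsMildSolution A T U₀ U →
          (∀ t ∈ Icc 0 T, U t = S t U₀) ∧
          ContinuousOn U (Icc 0 T) ∧
          (U₀ ∈ A.domain →
            IsStrictSolution A T U₀ U ∧ ContInDomain A T U ∧ ContDiffOn ℝ 1 U (Icc 0 T))) := by
  obtain ⟨S, hS, hG, hc, hi⟩ := hA.exists_contractionSemigroup hs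
  refine ⟨S, hS, hG, fun T hT U₀ => ?_⟩
  have hm : IsMildSolution A T U₀ fun t => S t U₀ :=
    ⟨(hc U₀).intervalIntegrable _ _, fun t ht => integral_orbit_mem_graph hS hG hc U₀ ht.1⟩
  refine ⟨⟨_, hm⟩, fun U hU => ?_⟩
  have hUS : ∀ t ∈ Icc 0 T, U t = S t U₀ := by
    intro t ht
    refine sub_eq_zero.1 (hA.mild_unique hs (W := fun t => U t - S t U₀) (hU.1.sub hm.1)
      (fun r hr => ?_) ht)
    have hmono : uIcc 0 r ⊆ uIcc 0 T := by
      rw [uIcc_of_le hr.1, uIcc_of_le hT.le]; exact Icc_subset_Icc_right hr.2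
    rw [intervalIntegral.integral_sub (hU.1.mono_set hmono) (hm.1.mono_set hmono)]
    have := A.graph.sub_mem (hU.2 r hr) (hm.2 r hr)
    rwa [Prod.mk_sub_mk, sub_sub_sub_cancel_right] at this
  refine ⟨hUS, (hc U₀).continuousOn.congr hUS, fun h0 => ?_⟩
  set y := A ⟨U₀, h0⟩ with hy
  have hxy : (U₀, y) ∈ A.graph := A.mem_graph ⟨U₀, h0⟩
  have hgr : ∀ t ∈ Icc 0 T, (U t, S t y) ∈ A.graph := fun t ht => by
    rw [hUS t ht]
    exact orbit_mem_graph hS hG hxy ht.1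
  have hdom : ∀ t ∈ Icc 0 T, U t ∈ A.domain := fun t ht =>
    LinearPMap.mem_domain_of_mem_graph (hgr t ht)
  have hval : ∀ (t : ℝ) (ht : t ∈ Icc 0 T), A ⟨U t, hdom t ht⟩ = S t y := fun t ht =>
    A.mem_graph_snd_inj (A.mem_graph ⟨U t, hdom t ht⟩) (hgr t ht) rfl
  -- `U` is controlled only on `[0, T]`; this function is `C¹` on all of `ℝ` and agrees with `U`
  -- there, so it handles the endpoints.
  have hd : ∀ t, HasDerivAt (fun t => U₀ + ∫ s in (0 : ℝ)..t, S s y) (S t y) t := fun t =>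
    (hasDerivAt_integral_orbit hc y t).const_add U₀
  have hUG : ∀ t ∈ Icc 0 T, U t = U₀ + ∫ s in (0 : ℝ)..t, S s y := fun t ht =>
    (hUS t ht).trans (hi _ _ hxy t ht.1)
  refine ⟨⟨?_, fun t ht => ⟨hdom t ht, ?_⟩⟩, ⟨fun t => hdom t t.2, ?_⟩, ?_⟩
  · rw [hUS 0 (left_mem_Icc.2 hT.le), hS.zero]; rfl
  · rw [hval t ht]
    exact (hd t).hasDerivWithinAt.congr hUG (hUG t ht)
  · have h1 : Continuous fun t : Icc 0 T => (S t U₀, S t y) :=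
      ((hc U₀).comp continuous_subtype_val).prodMk ((hc y).comp continuous_subtype_val)
    exact h1.congr fun t => by rw [hval t t.2, hUS t t.2]
  · have h1 : ContDiff ℝ 1 fun t => U₀ + ∫ s in (0 : ℝ)..t, S s y := by
      rw [contDiff_one_iff_deriv]
      refine ⟨fun t => (hd t).differentiableAt, ?_⟩
      rw [show deriv (fun t => U₀ + ∫ s in (0 : ℝ)..t, S s y) = fun t => S t y from
        funext fun t => (hd t).deriv]
      exact hc y
    exact h1.contDiffOn.congr hUG

end Cauchy

/-! ### Integration by parts in `H¹(0, ℓ)` -/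

lemma integral_mul_primitive {ℓ : ℝ} (φ ψ : ℝ → ℂ) :
    ∫ x in Ioo 0 ℓ, φ x * ∫ t in (0 : ℝ)..x, ψ t =
      ∫ x in Ioo 0 ℓ, ∫ t in Ioo 0 ℓ,
        ({p : ℝ × ℝ | p.2 < p.1}.indicator fun p => φ p.1 * ψ p.2) (x, t) := by
  refine setIntegral_congr_fun measurableSet_Ioo fun x hx => ?_
  rw [primitive_eq ψ hx, ← integral_const_mul]
  congr 1
  ext t
  by_cases h : t < x <;> simp [indicator, h]

/-- Integration by parts for primitives. -/
lemma primitive_mul_primitive {ℓ : ℝ} (hℓ : 0 < ℓ) {φ ψ : ℝ → ℂ} (hφ : IntegrableOn φ (Ioo 0 ℓ))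
    (hψ : IntegrableOn ψ (Ioo 0 ℓ)) :
    (∫ x in Ioo 0 ℓ, φ x * ∫ t in (0 : ℝ)..x, ψ t) +
      (∫ x in Ioo 0 ℓ, (∫ t in (0 : ℝ)..x, φ t) * ψ x) =
      (∫ x in (0 : ℝ)..ℓ, φ x) * ∫ x in (0 : ℝ)..ℓ, ψ x := by
  have e : ∀ g : ℝ → ℂ, ∫ x in (0 : ℝ)..ℓ, g x = ∫ x in Ioo 0 ℓ, g x := fun g => by
    rw [intervalIntegral.integral_of_le hℓ.le, integral_Ioc_eq_integral_Ioo]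
  have hprod : Integrable (fun p : ℝ × ℝ => φ p.1 * ψ p.2)
      ((volume.restrict (Ioo 0 ℓ)).prod (volume.restrict (Ioo 0 ℓ))) := hφ.mul_prod hψ
  have h1 : Integrable ({p : ℝ × ℝ | p.2 < p.1}.indicator fun p => φ p.1 * ψ p.2)
      ((volume.restrict (Ioo 0 ℓ)).prod (volume.restrict (Ioo 0 ℓ))) :=
    hprod.indicator (measurableSet_lt measurable_snd measurable_fst)
  have h2 : Integrable ({p : ℝ × ℝ | p.1 < p.2}.indicator fun p => φ p.1 * ψ p.2)
      ((volume.restrict (Ioo 0 ℓ)).prod (volume.restrict (Ioo 0 ℓ))) :=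
    hprod.indicator (measurableSet_lt measurable_fst measurable_snd)
  have e1 := integral_mul_primitive (ℓ := ℓ) φ ψ
  have e2 : ∫ x in Ioo 0 ℓ, (∫ t in (0 : ℝ)..x, φ t) * ψ x = ∫ t in Ioo 0 ℓ, ∫ x in Ioo 0 ℓ,
      ({p : ℝ × ℝ | p.1 < p.2}.indicator fun p => φ p.1 * ψ p.2) (x, t) := by
    refine setIntegral_congr_fun measurableSet_Ioo fun x hx => ?_
    rw [primitive_eq φ hx, ← integral_mul_const]
    congr 1
    ext t
    by_cases h : t < x <;> simp [indicator, h]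
  -- The two terms are integrals of `φ(x) ψ(t)` over the triangles `t < x` and `x < t`, which fill
  -- the square up to the null diagonal.
  rw [e1, e2, integral_integral_swap (f := fun t x =>
      ({p : ℝ × ℝ | p.1 < p.2}.indicator fun p => φ p.1 * ψ p.2) (x, t)) h2.swap,
    integral_integral (f := fun x t =>
      ({p : ℝ × ℝ | p.2 < p.1}.indicator fun p => φ p.1 * ψ p.2) (x, t)) h1,
    integral_integral (f := fun x t =>
      ({p : ℝ × ℝ | p.1 < p.2}.indicator fun p => φ p.1 * ψ p.2) (x, t)) h2,
    ← integral_add h1 h2, e, e, ← integral_prod_mul]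
  refine integral_congr_ae ?_
  have hdiag : ∀ᵐ p ∂(volume.restrict (Ioo 0 ℓ)).prod (volume.restrict (Ioo (0 : ℝ) ℓ)),
      p.1 ≠ p.2 := by
    have hm : MeasurableSet {p : ℝ × ℝ | p.1 ≠ p.2} :=
      (measurableSet_eq_fun measurable_fst measurable_snd).compl
    refine (Measure.ae_prod_iff_ae_ae hm).2 (ae_of_all _ fun x => ?_)
    filter_upwards [ae_restrict_of_ae (Measure.ae_ne volume x)] with t ht
    exact ht.symm
  filter_upwards [hdiag] with p hp
  rcases lt_or_gt_of_ne hp with h | h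
  · simp [indicator, h, h.le.not_gt]
  · simp [indicator, h, h.le.not_gt]

/-- A function in `H¹(0, ℓ)` is the primitive of its weak derivative. -/
lemma MemH.ae_eq_primitive {ℓ : ℝ} (hℓ : 0 < ℓ) {f : L2 ℓ} (h : MemH 1 f) :
    f =ᵐ[volume.restrict (Ioo 0 ℓ)] fun x => trace f 0 + ∫ t in (0 : ℝ)..x, wderiv f t := by
  have hw := h.isWeakDeriv
  have hc := primitive_cont hℓ (intOn (wderiv f))
  have hi : IntegrableOn (fun x => ∫ t in (0 : ℝ)..x, wderiv f t) (Ioo 0 ℓ) :=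
    hc.integrableOn_Icc.mono_set Ioo_subset_Icc_self
  obtain ⟨c, hcc⟩ := ae_const hℓ (f := fun x => f x - ∫ t in (0 : ℝ)..x, wderiv f t)
    ((intOn f).sub hi) (fun φ hφ => by
      simp only [smul_sub]
      rw [integral_sub (hφ.int_deriv_smul (intOn f)) (hφ.int_deriv_smul hi), hw φ hφ,
        primitive_parts (intOn _) hφ, sub_self])
  have h1 : f =ᵐ[volume.restrict (Ioo 0 ℓ)] fun x => c + ∫ t in (0 : ℝ)..x, wderiv f t := by
    filter_upwards [hcc] with x hx
    rw [← hx]; ring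
  have h2 : trace f 0 = c + ∫ t in (0 : ℝ)..0, wderiv f t :=
    trace_eq hℓ (continuousOn_const.add hc) h1 (left_mem_Icc.2 hℓ.le)
  rw [intervalIntegral.integral_same, add_zero] at h2
  rwa [h2]

lemma MemH.trace_eq_primitive {ℓ : ℝ} (hℓ : 0 < ℓ) {f : L2 ℓ} (h : MemH 1 f) {x : ℝ}
    (hx : x ∈ Icc 0 ℓ) : trace f x = trace f 0 + ∫ t in (0 : ℝ)..x, wderiv f t :=
  trace_eq hℓ (continuousOn_const.add (primitive_cont hℓ (intOn (wderiv f))))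
    (h.ae_eq_primitive hℓ) hx

lemma integral_const_add_mul {ℓ : ℝ} (hℓ : 0 < ℓ) {φ ψ : ℝ → ℂ} (hφ : IntegrableOn φ (Ioo 0 ℓ))
    (hψ : IntegrableOn ψ (Ioo 0 ℓ)) (a : ℂ) :
    ∫ x in Ioo 0 ℓ, (a + ∫ t in (0 : ℝ)..x, φ t) * ψ x =
      a * (∫ x in (0 : ℝ)..ℓ, ψ x) + ∫ x in Ioo 0 ℓ, (∫ t in (0 : ℝ)..x, φ t) * ψ x := by
  have hc := primitive_cont hℓ hφ
  obtain ⟨C, hC⟩ := isCompact_Icc.exists_bound_of_continuousOn hc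
  have hi : IntegrableOn (fun x => (∫ t in (0 : ℝ)..x, φ t) * ψ x) (Ioo 0 ℓ) :=
    Integrable.bdd_mul hψ
      ((hc.mono Ioo_subset_Icc_self).aestronglyMeasurable measurableSet_Ioo)
      ((ae_restrict_iff' measurableSet_Ioo).2
        (ae_of_all _ fun x hx => hC x (Ioo_subset_Icc_self hx)))
  have ha : IntegrableOn (fun x => a * ψ x) (Ioo 0 ℓ) := hψ.const_mul a
  simp only [add_mul]
  rw [integral_add ha hi, integral_const_mul, intervalIntegral.integral_of_le hℓ.le,
    integral_Ioc_eq_integral_Ioo]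

/-- Integration by parts in `H¹(0, ℓ)`. -/
lemma MemH.inner_wderiv {ℓ : ℝ} (hℓ : 0 < ℓ) {f g : L2 ℓ} (hf : MemH 1 f) (hg : MemH 1 g) :
    inner ℂ f (wderiv g) = star (trace f ℓ) * trace g ℓ - star (trace f 0) * trace g 0
      - inner ℂ (wderiv f) g := by
  have hr : ℓ ∈ Icc 0 ℓ := right_mem_Icc.2 hℓ.le
  have hφ : IntegrableOn (fun x => star (wderiv f x)) (Ioo 0 ℓ) :=
    (Complex.conjCLE : ℂ →L[ℝ] ℂ).integrable_comp (intOn (wderiv f))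
  have hconj : ∀ x : ℝ, ∫ t in (0 : ℝ)..x, star (wderiv f t)
      = star (∫ t in (0 : ℝ)..x, wderiv f t) := by
    intro x
    simp only [intervalIntegral, star_sub]
    congr 1 <;> exact integral_conj
  have k1 := integral_const_add_mul hℓ hφ (intOn (wderiv g)) (star (trace f 0))
  have k2 := integral_const_add_mul hℓ (intOn (wderiv g)) hφ (trace g 0)
  have e1 : inner ℂ f (wderiv g) = ∫ x in Ioo 0 ℓ,
      (star (trace f 0) + ∫ t in (0 : ℝ)..x, star (wderiv f t)) * wderiv g x := by
    rw [L2.inner_def]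
    refine integral_congr_ae ?_
    filter_upwards [hf.ae_eq_primitive hℓ] with x hx
    rw [hx, hconj, ← star_add, RCLike.inner_apply, mul_comm]
    rfl
  have e2 : inner ℂ (wderiv f) g = ∫ x in Ioo 0 ℓ,
      (trace g 0 + ∫ t in (0 : ℝ)..x, wderiv g t) * star (wderiv f x) := by
    rw [L2.inner_def]
    refine integral_congr_ae ?_
    filter_upwards [hg.ae_eq_primitive hℓ] with x hx
    rw [hx, RCLike.inner_apply]
    rfl
  have k3 := primitive_mul_primitive hℓ hφ (intOn (wderiv g))
  have k4 : ∫ x in Ioo 0 ℓ, (∫ t in (0 : ℝ)..x, wderiv g t) * star (wderiv f x)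
      = ∫ x in Ioo 0 ℓ, star (wderiv f x) * ∫ t in (0 : ℝ)..x, wderiv g t := by
    simp only [mul_comm]
  rw [e1, e2, k1, k2, k4, hf.trace_eq_primitive hℓ hr, hg.trace_eq_primitive hℓ hr, star_add,
    ← hconj]
  linear_combination k3

/-- There is a primitive in `L²(0, ℓ)` with a given value at `0`. -/
lemma exists_primitive_trace_zero {ℓ : ℝ} (hℓ : 0 < ℓ) (g : L2 ℓ) (a : ℂ) :
    ∃ f : L2 ℓ, IsWeakDeriv ℓ f g ∧ trace f 0 = a := by
  have hx : (0 : ℝ) ∈ Icc 0 ℓ := left_mem_Icc.2 hℓ.le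
  obtain ⟨f, hf, -⟩ := exists_primitive hℓ g
  -- The constant function `1` has zero weak derivative; a multiple of it corrects the value at `0`.
  let c : L2 ℓ := (memLp_const (1 : ℂ)).toLp _
  have hc : c =ᵐ[volume.restrict (Ioo 0 ℓ)] fun _ => (1 : ℂ) := MemLp.coeFn_toLp _
  have hcw : IsWeakDeriv ℓ c 0 := by
    intro φ hφ
    have hdc : Continuous (deriv φ) := hφ.smooth.continuous_deriv (by simp)
    have e1 : ∫ x in Ioo 0 ℓ, deriv φ x • c x = ∫ x in Ioo 0 ℓ, deriv φ x • (1 : ℂ) := by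
      refine integral_congr_ae ?_
      filter_upwards [hc] with x hx
      rw [hx]
    have e2 : ∫ x in Ioo 0 ℓ, φ x • (0 : L2 ℓ) x = 0 := by
      refine integral_eq_zero_of_ae ?_
      filter_upwards [Lp.coeFn_zero ℂ 2 (volume.restrict (Ioo (0 : ℝ) ℓ))] with x hx
      rw [hx]; simp
    rw [e1, e2, neg_zero, integral_smul_const, ← integral_Ioc_eq_integral_Ioo,
      ← intervalIntegral.integral_of_le hℓ.le, intervalIntegral.integral_deriv_eq_sub
        (fun x _ => (hφ.smooth.differentiable (by simp)).differentiableAt)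
        (hdc.intervalIntegrable _ _), hφ.apply_left (x := ℓ) (by simp),
      hφ.apply_left (x := 0) (by simp), sub_self, zero_smul]
  have hct : trace c 0 = 1 := trace_eq hℓ continuousOn_const hc hx
  have hc1 : MemH 1 c := ⟨0, hcw, trivial⟩
  have hf1 : MemH 1 f := ⟨g, hf, trivial⟩
  refine ⟨f + (a - trace f 0) • c, by simpa using hf.add (hcw.smul (a - trace f 0)), ?_⟩
  rw [trace_add hℓ hf1 (hc1.smul _) hx, trace_smul hℓ _ hc1 hx, hct]
  ring

/-! ### The beam operators -/

variable {p : Beam}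

open PhaseSpace

/-- `A` is the beam operator with boundary damping matrix `M`. -/
def IsBeamOp (M : Matrix (Fin 2) (Fin 2) ℂ) (A : PhaseSpace p →ₗ.[ℂ] PhaseSpace p) : Prop :=
  ∀ U W, (U, W) ∈ A.graph ↔ U ∈ domainA p ∧ W.u = U.v ∧
    W.v = -(p.α : ℂ) • wderiv (wderiv (wderiv (wderiv U.u))) ∧
    W.V = (matB p)⁻¹ *ᵥ (boundaryForce U.u - M *ᵥ U.V)

lemma isBeamOp_opA₀ : IsBeamOp 0 (opA₀ p) := by
  intro U W
  rw [LinearPMap.mem_graph_iff]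
  constructor
  · rintro ⟨⟨U', hU⟩, h1, h2⟩
    obtain rfl : U' = U := h1
    obtain rfl : _ = W := h2
    refine ⟨hU, rfl, rfl, ?_⟩
    rw [Matrix.zero_mulVec, sub_zero]
    rfl
  · rintro ⟨hU, h1, h2, h3⟩
    refine ⟨⟨U, hU⟩, rfl, PhaseSpace.ext h1.symm h2.symm ?_⟩
    rw [Matrix.zero_mulVec, sub_zero] at h3
    exact h3.symm

lemma isBeamOp_opA : IsBeamOp (matK p) (opA p) := by
  intro U W
  rw [LinearPMap.mem_graph_iff]
  have e1 : ∀ hU : U ∈ domainA p, (opA p ⟨U, hU⟩).u = U.v := fun hU => sub_zero _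
  have e2 : ∀ hU : U ∈ domainA p, (opA p ⟨U, hU⟩).v =
      -(p.α : ℂ) • wderiv (wderiv (wderiv (wderiv U.u))) := fun hU => sub_zero _
  have e3 : ∀ hU : U ∈ domainA p, (opA p ⟨U, hU⟩).V =
      (matB p)⁻¹ *ᵥ (boundaryForce U.u - matK p *ᵥ U.V) := fun hU => by
    rw [Matrix.mulVec_sub]
    rfl
  constructor
  · rintro ⟨⟨U', hU⟩, h1, h2⟩
    obtain rfl : U' = U := h1
    obtain rfl : _ = W := h2
    exact ⟨hU, e1 hU, e2 hU, e3 hU⟩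
  · rintro ⟨hU, h1, h2, h3⟩
    exact ⟨⟨U, hU⟩, rfl, PhaseSpace.ext ((e1 hU).trans h1.symm) ((e2 hU).trans h2.symm)
      ((e3 hU).trans h3.symm)⟩

lemma isUnit_det_matB : IsUnit (matB p).det := by
  have h2 : (p.m : ℂ) ≠ 0 := by exact_mod_cast p.m_pos.ne'
  have h3 : (p.J : ℂ) ≠ 0 := by exact_mod_cast p.J_pos.ne'
  have : (matB p).det = p.m * p.J := by
    rw [matB, Matrix.det_fin_two_of]
    ring
  rw [this]
  exact (mul_ne_zero h2 h3).isUnit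

lemma matB_mulVec_inv (x : Fin 2 → ℂ) : matB p *ᵥ ((matB p)⁻¹ *ᵥ x) = x := by
  rw [Matrix.mulVec_mulVec, Matrix.mul_nonsing_inv _ isUnit_det_matB, Matrix.one_mulVec]

lemma inv_mulVec_matB (x : Fin 2 → ℂ) : (matB p)⁻¹ *ᵥ (matB p *ᵥ x) = x := by
  rw [Matrix.mulVec_mulVec, Matrix.nonsing_inv_mul _ isUnit_det_matB, Matrix.one_mulVec]

/-- Green's formula for the beam. -/
lemma inner_wderiv_four {u v : L2 p.ℓ} (hu : MemH 4 u) (hv : v ∈ clamped p) :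
    inner ℂ v (wderiv (wderiv (wderiv (wderiv u)))) =
      - (star (trace v 0) * trace (wderiv (wderiv (wderiv u))) 0)
      + star (trace (wderiv v) 0) * trace (wderiv (wderiv u)) 0
      + inner ℂ (wderiv (wderiv v)) (wderiv (wderiv u)) := by
  obtain ⟨h1, h2, h3⟩ := hv
  have h4 := hu.wderiv_mem.wderiv_mem
  rw [MemH.inner_wderiv p.ℓ_pos h1.one h4.wderiv_mem.one,
    MemH.inner_wderiv p.ℓ_pos h1.wderiv_mem h4.one, h2, h3]
  simp only [star_zero, zero_mul]
  ring

/-- The couplings `w = v(0)`, `z = v_x(0)` make `V̄ · Γ(u)` cancel the boundary terms of Green's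
formula. What remains is a number minus its conjugate, and `- V̄ · M V`. -/
lemma IsBeamOp.dissipative {M : Matrix (Fin 2) (Fin 2) ℂ} {A : PhaseSpace p →ₗ.[ℂ] PhaseSpace p}
    (hA : IsBeamOp M A) (hM : ∀ x, 0 ≤ (star x ⬝ᵥ (M *ᵥ x)).re) : Dissipative A := by
  intro U W h
  obtain ⟨⟨d1, d2, d3, d4⟩, h1, h2, h3⟩ := (hA U W).1 h
  have e : inner ℂ U W = inner ℂ U.v W.v + p.α * inner ℂ U.uxx W.uxx
    + star U.V ⬝ᵥ (matB p *ᵥ W.V) := rfl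
  have e1 : U.uxx = wderiv (wderiv U.u) := rfl
  have e2 : W.uxx = wderiv (wderiv U.v) := by rw [← h1]; rfl
  have e3 : star U.V ⬝ᵥ boundaryForce U.u =
      - p.α * (star (trace U.v 0) * trace (wderiv (wderiv (wderiv U.u))) 0)
      + p.α * (star (trace (wderiv U.v) 0) * trace (wderiv (wderiv U.u)) 0) := by
    rw [dotProduct, Fin.sum_univ_two, Pi.star_apply, Pi.star_apply, d3, d4]
    simp only [boundaryForce, Matrix.cons_val_zero, Matrix.cons_val_one]
    ring
  have e4 : inner ℂ U W =
      p.α * (inner ℂ (wderiv (wderiv U.u)) (wderiv (wderiv U.v))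
        - inner ℂ (wderiv (wderiv U.v)) (wderiv (wderiv U.u)))
      - star U.V ⬝ᵥ (M *ᵥ U.V) := by
    rw [e, h2, h3, matB_mulVec_inv, dotProduct_sub, e3, inner_smul_right,
      inner_wderiv_four d1 d2, e1, e2]
    ring
  rw [e4, Complex.sub_re, Complex.re_ofReal_mul, Complex.sub_re,
    ← inner_conj_symm (wderiv (wderiv U.u)), Complex.conj_re, sub_self, mul_zero, zero_sub]
  exact neg_nonpos.2 (hM _)

lemma IsBeamOp.surj {M : Matrix (Fin 2) (Fin 2) ℂ} {A : PhaseSpace p →ₗ.[ℂ] PhaseSpace p}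
    (hA : IsBeamOp M A) : Surj A := by
  intro W
  have hα : (p.α : ℂ) ≠ 0 := by exact_mod_cast p.α_pos.ne'
  -- The equation forces `v = W.u`, so the domain conditions fix `V`, and the last component forces
  -- the boundary force to equal `G`. Below, `q` is `u_xxx` and `r` is `u_xx`: both are integrated
  -- from `0` with values read off from `G`, and the last two integrations use the clamped end.
  let V : Fin 2 → ℂ := ![trace W.u 0, trace (wderiv W.u) 0]
  let G : Fin 2 → ℂ := matB p *ᵥ W.V + M *ᵥ V
  obtain ⟨q, hq, hq0⟩ := exists_primitive_trace_zero p.ℓ_pos (-(p.α : ℂ)⁻¹ • W.v)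
    (-(p.α : ℂ)⁻¹ * G 0)
  obtain ⟨r, hr, hr0⟩ := exists_primitive_trace_zero p.ℓ_pos q ((p.α : ℂ)⁻¹ * G 1)
  obtain ⟨u, hu⟩ := exists_uxx_eq r
  have hu2 : MemH 2 (u : L2 p.ℓ) := u.2.1
  have hu4 : MemH 4 (u : L2 p.ℓ) := by
    refine ⟨_, hu2.isWeakDeriv, _, hu2.wderiv_mem.isWeakDeriv, ?_⟩
    rw [hu]
    exact ⟨q, hr, _, hq, trivial⟩
  refine ⟨mk u W.u V, (hA _ _).2 ⟨⟨hu4, W.u_mem, rfl, rfl⟩, rfl, ?_, ?_⟩⟩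
  · rw [u_mk, hu, hr.wderiv_eq, hq.wderiv_eq, smul_smul, neg_mul_neg, mul_inv_cancel₀ hα, one_smul]
  · have e : boundaryForce (u : L2 p.ℓ) = G := by
      rw [boundaryForce, hu, hr.wderiv_eq, hq0, hr0]
      ext i
      fin_cases i
      · change -(p.α : ℂ) * (-(p.α : ℂ)⁻¹ * G 0) = G 0
        rw [← mul_assoc, neg_mul_neg, mul_inv_cancel₀ hα, one_mul]
      · change (p.α : ℂ) * ((p.α : ℂ)⁻¹ * G 1) = G 1
        rw [← mul_assoc, mul_inv_cancel₀ hα, one_mul]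
    rw [u_mk, V_mk, e, add_sub_cancel_right, inv_mulVec_matB]

/-- Completing the square gives `γ |x₀ + (d/2) x₁|² + d (γs - dγ/4) |x₁|²`, and `dγ ≤ 2γs` bounds
the last bracket below by `γs / 2`. -/
lemma matK_accretive (hd : 0 ≤ p.d) (hγ : 0 ≤ p.γ) (hγs : 0 ≤ p.γs)
    (hdγ : p.d * p.γ ≤ 2 * p.γs) (x : Fin 2 → ℂ) : 0 ≤ (star x ⬝ᵥ (matK p *ᵥ x)).re := by
  have e : (star x ⬝ᵥ (matK p *ᵥ x)).re = p.γ * ((x 0).re ^ 2 + (x 0).im ^ 2)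
      + p.d * p.γ * ((x 1).re * (x 0).re + (x 1).im * (x 0).im)
      + p.d * p.γs * ((x 1).re ^ 2 + (x 1).im ^ 2) := by
    simp [matK, dotProduct, Matrix.mulVec, Fin.sum_univ_two]
    ring
  rw [e]
  have h1 : p.d * (p.d * p.γ) * ((x 1).re ^ 2 + (x 1).im ^ 2)
      ≤ p.d * (2 * p.γs) * ((x 1).re ^ 2 + (x 1).im ^ 2) := by
    gcongr
  have h2 : 0 ≤ p.γ * (((x 0).re + p.d / 2 * (x 1).re) ^ 2 + ((x 0).im + p.d / 2 * (x 1).im) ^ 2) := by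
    positivity
  have h3 : 0 ≤ p.d * p.γs * ((x 1).re ^ 2 + (x 1).im ^ 2) := by positivity
  nlinarith

end HybridBeam

end

open HybridBeam
theorem mainTheorem6 (p : Beam) (hd : 0 ≤ p.d) (hγ : 0 ≤ p.γ) (hγs : 0 ≤ p.γs)
    (hdγ : p.d * p.γ ≤ 2 * p.γs) :
    ∀ A ∈ ({opA p, opA₀ p} : Set (PhaseSpace p →ₗ.[ℂ] PhaseSpace p)),
      ∃ S : ℝ → PhaseSpace p →L[ℂ] PhaseSpace p,
        IsContractionSemigroup S ∧ IsGenerator A S ∧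
        ∀ T : ℝ, 0 < T → ∀ U₀ : PhaseSpace p,
          (∃ U : ℝ → PhaseSpace p, IsMildSolution A T U₀ U) ∧
          (∀ U : ℝ → PhaseSpace p, IsMildSolution A T U₀ U →
            (∀ t ∈ Icc 0 T, U t = S t U₀) ∧
            ContinuousOn U (Icc 0 T) ∧
            (U₀ ∈ A.domain →
              IsStrictSolution A T U₀ U ∧
              ContInDomain A T U ∧
              ContDiffOn ℝ 1 U (Icc 0 T))) := by
  rintro A (rfl | rfl)
  · exact (isBeamOp_opA.dissipative (matK_accretive hd hγ hγs hdγ)).wellPosed isBeamOp_opA.surj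
  · exact (isBeamOp_opA₀.dissipative fun x => by simp).wellPosed isBeamOp_opA₀.surj
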